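/- **Notation.** For a finitely supported sequence (mask) $\boldsymbol A=(\boldsymbol A_j)_{j\in\mathbb Z}$ of real $2\times 2$ matrices, the subdivision operator $S_{\boldsymbol A}$ acts on sequences $\mathbf c:\mathbb Z\to\mathbb R^2$ by $(S_{\boldsymbol A}\mathbf c)_j=\sum_{k\in\mathbb Z}\boldsymbol A_{j-2k}\mathbf c_k$. Write $\|\mathbf c\|_\infty=\sup_j|\mathbf c_j|_\infty$ and $\|S\|_\infty=\sup\{\|S\mathbf c\|_\infty:\|\mathbf c\|_\infty=1\}$; $S$ is *contractive* if $\|S^N\|_\infty<1$ for some $N\ge 1$. $S_{\boldsymbol A}$ has *spectral order* $d\ge 1$ if for each $k=0,\dots,d$ there is a real polynomial $\mathscr P_k$ of degree at most $k$, with coefficient of $x^k$ equal to $1/k!$, such that $S_{\boldsymbol A}\begin{bmatrix}\mathscr P_k\\ \mathscr P_k'\end{bmatrix}=2^{-k}\begin{bmatrix}\mathscr P_k\\ \mathscr P_k'\end{bmatrix}$, the functions being sampled on $\mathbb Z$. With $(\Delta c)_j=c_{j+1}-c_j$ and the Gregory coefficients $G_n=\frac1{n!}\sum_{j=0}^n\left[{n\atop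 j}\right]\frac{(-1)^{n-j}}{j+1}$, where $\left[{n\atop j}\right]$ are the unsigned Stirling numbers of the first kind, the $d$-th Gregory operator is $$\mathscr G^{[d]}=\begin{bmatrix}0&\Delta^d\\ \Delta&-\sum_{\ell=0}^{d-1}G_\ell\Delta^\ell\end{bmatrix}.$$ The Hermite subdivision scheme associated with $S_{\boldsymbol A}$ produces from $\mathbf c^{[0]}$ the sequences $\mathbf c^{[n]}$ with $\boldsymbol D^{n+1}\mathbf c^{[n+1]}=S_{\boldsymbol A}\boldsymbol D^n\mathbf c^{[n]}$, $n\ge0$, where $\boldsymbol D=\operatorname{diag}(1,1/2)$. It is *$C^d$-convergent* ($d\ge1$) if for every bounded $\mathbf c^{[0]}$ there is $\varphi\in C^d(\mathbb R)$ such that, with $\Phi=[\varphi,\varphi']^T$, for every compact $K\subset\mathbb R$ $$\lim_{n\to\infty}\ \sup_{j\in\mathbb Z,\ 2^{-n}j\in K}\bigl|\mathbf c^{[n]}_j-\Phi(2^{-n}j)\bigr|_\infty=0,$$ and $\varphi\ne0$ for at least one bounded $\mathbf c^{[0]}$. **Corollary.** Let $d\ge1$ and let $S_{\boldsymbol A}$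 be a subdivision operator of spectral order $d$. Then there exists a subdivision operator $S_{\boldsymbol B}$ (with finitely supported mask) such that $$\mathscr G^{[d]}S_{\boldsymbol A}=2^{-d}S_{\boldsymbol B}\,\mathscr G^{[d]}.$$ Moreover, whenever a subdivision operator $S_{\boldsymbol B}$ satisfies this identity and is contractive, the Hermite subdivision scheme associated with $S_{\boldsymbol A}$ is $C^d$-convergent. -/

import Mathlib

/-!
Hermite subdivision schemes refining function values and first derivatives.
Sequences of vectors in `ℝ²` are functions `ℤ → Fin 2 → ℝ`; coordinate `0` is the function value
and coordinate `1` the derivative. The norm of `Fin 2 → ℝ` is the maximum norm. Masks are finitely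
supported sequences of real `2 × 2` matrices.
-/

namespace HermiteSubdivision

/-- The subdivision operator with mask `A`: `(S_A c)_j = ∑_k A_{j - 2k} c_k`.
The sum has finitely many nonzero terms since `A` has finite support. -/
noncomputable def subdivOp (A : ℤ →₀ Matrix (Fin 2) (Fin 2) ℝ) (c : ℤ → Fin 2 → ℝ) :
    ℤ → Fin 2 → ℝ :=
  fun j => ∑ᶠ k : ℤ, (A (j - 2 * k)).mulVec (c k)

/-- The supremum norm of a sequence, with value `⊤` exactly when the sequence is unbounded. -/
noncomputable def seqNorm (c : ℤ → Fin 2 → ℝ) : ENNReal :=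
  ⨆ j : ℤ, ‖c j‖ₑ

/-- The operator norm `sup {‖S c‖_∞ : ‖c‖_∞ = 1}`. -/
noncomputable def opNorm (S : (ℤ → Fin 2 → ℝ) → ℤ → Fin 2 → ℝ) : ENNReal :=
  ⨆ (c : ℤ → Fin 2 → ℝ) (_ : seqNorm c = 1), seqNorm (S c)

/-- An operator is contractive if some power of it has norm less than `1`. -/
def IsContractive (S : (ℤ → Fin 2 → ℝ) → ℤ → Fin 2 → ℝ) : Prop :=
  ∃ N : ℕ, 1 ≤ N ∧ opNorm (S^[N]) < 1

/-- The sequence `j ↦ (p(j), p'(j))` of a polynomial `p`. -/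
noncomputable def polySample (p : Polynomial ℝ) : ℤ → Fin 2 → ℝ :=
  fun j => ![p.eval (j : ℝ), p.derivative.eval (j : ℝ)]

/-- The spectral condition of order `d`: for `k = 0, …, d` there is a polynomial `P k` of degree at
most `k` with `k`-th coefficient `1 / k!` and `S_A (P k, (P k)') = 2^{-k} (P k, (P k)')`. -/
def HasSpectralOrder (A : ℤ →₀ Matrix (Fin 2) (Fin 2) ℝ) (d : ℕ) : Prop :=
  ∃ P : ℕ → Polynomial ℝ, ∀ k ≤ d,
    (P k).natDegree ≤ k ∧ (P k).coeff k = 1 / (k.factorial : ℝ) ∧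
      subdivOp A (polySample (P k)) = ((1 / 2 : ℝ) ^ k) • polySample (P k)

/-- The Gregory coefficients `G_n = (1 / n!) ∑_{j ≤ n} [n, j] (-1)^{n - j} / (j + 1)`, where `[n, j]`
is the unsigned Stirling number of the first kind. -/
noncomputable def gregoryCoeff (n : ℕ) : ℝ :=
  (1 / (n.factorial : ℝ)) *
    ∑ j ∈ Finset.range (n + 1), (Nat.stirlingFirst n j : ℝ) * ((-1) ^ (n - j) / ((j : ℝ) + 1))

/-- The `n`-th Gregory operator
`(c₀, c₁) ↦ (Δⁿ c₁, Δ c₀ - ∑_{ℓ < n} G_ℓ Δ^ℓ c₁)`, with `(Δ f)_j = f_{j+1} - f_j`. -/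
noncomputable def gregoryOp (n : ℕ) (c : ℤ → Fin 2 → ℝ) : ℤ → Fin 2 → ℝ :=
  fun j =>
    ![((fwdDiff (1 : ℤ))^[n] fun i => c i 1) j,
      fwdDiff (1 : ℤ) (fun i => c i 0) j -
        ∑ l ∈ Finset.range n, gregoryCoeff l * ((fwdDiff (1 : ℤ))^[l] fun i => c i 1) j]

/-- The diagonal matrix `D = diag(1, 1/2)`. -/
noncomputable def hermiteD : Matrix (Fin 2) (Fin 2) ℝ :=
  Matrix.diagonal ![1, 1 / 2]

/-- `IsHermiteSeq A c` says that the sequences `c 0, c 1, c 2, …` are produced from the initial data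
`c 0` by the Hermite subdivision scheme of `S_A`: `D^{n+1} c^{[n+1]} = S_A D^n c^{[n]}`. -/
def IsHermiteSeq (A : ℤ →₀ Matrix (Fin 2) (Fin 2) ℝ) (c : ℕ → ℤ → Fin 2 → ℝ) : Prop :=
  ∀ n : ℕ, (fun j => (hermiteD ^ (n + 1)).mulVec (c (n + 1) j)) =
    subdivOp A (fun j => (hermiteD ^ n).mulVec (c n j))

/-- Every initial sequence determines exactly one run of the scheme. -/
theorem existsUnique_isHermiteSeq (A : ℤ →₀ Matrix (Fin 2) (Fin 2) ℝ) (c₀ : ℤ → Fin 2 → ℝ) :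
    ∃! c : ℕ → ℤ → Fin 2 → ℝ, c 0 = c₀ ∧ IsHermiteSeq A c := by
  have hD : IsUnit hermiteD.det := by
    simp [hermiteD, Matrix.det_diagonal]
  have hu : ∀ n : ℕ, IsUnit (hermiteD ^ n).det := fun n => by
    rw [Matrix.det_pow]; exact hD.pow n
  refine ⟨fun n => Nat.rec c₀ (fun n c => fun j => ((hermiteD ^ (n + 1))⁻¹).mulVec
    (subdivOp A (fun j => (hermiteD ^ n).mulVec (c j)) j)) n, ⟨rfl, ?_⟩, ?_⟩
  · intro n
    funext j
    simp only [Matrix.mulVec_mulVec, Matrix.mul_nonsing_inv _ (hu (n + 1)), Matrix.one_mulVec]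
  · rintro c ⟨h0, hc⟩
    funext n
    induction n with
    | zero => exact h0
    | succ n ih =>
      funext j
      have h := congrFun (hc n) j
      simp only at h ih ⊢
      rw [← ih, ← h, Matrix.mulVec_mulVec, Matrix.nonsing_inv_mul _ (hu (n + 1)),
        Matrix.one_mulVec]

/-- The sequences `c n`, placed on the grids `2^{-n} ℤ`, converge to `(φ, φ')` uniformly on every
compact set `K`: the supremum over `2^{-n} j ∈ K` of `|c^{[n]}_j - (φ, φ')(2^{-n} j)|` tends to
`0`. -/
def HermiteTendsto (c : ℕ → ℤ → Fin 2 → ℝ) (φ : ℝ → ℝ) : Prop :=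
  ∀ K : Set ℝ, IsCompact K →
    Filter.Tendsto
      (fun n : ℕ => ⨆ (j : ℤ) (_ : (j : ℝ) / 2 ^ n ∈ K),
        ‖c n j - ![φ ((j : ℝ) / 2 ^ n), deriv φ ((j : ℝ) / 2 ^ n)]‖ₑ)
      Filter.atTop (nhds (0 : ENNReal))

/-- `C^d`-convergence (`d ≥ 1`) of the Hermite subdivision scheme of `S_A`: all bounded initial data
lead to a limit `(φ, φ')` with `φ` of class `C^d`, and some bounded initial data have a limit
with `φ ≠ 0`. -/
def IsHermiteConvergent (A : ℤ →₀ Matrix (Fin 2) (Fin 2) ℝ) (d : ℕ) : Prop :=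
  (∀ c : ℕ → ℤ → Fin 2 → ℝ, IsHermiteSeq A c → seqNorm (c 0) < ⊤ →
    ∃ φ : ℝ → ℝ, ContDiff ℝ d φ ∧ HermiteTendsto c φ) ∧
  (∃ (c : ℕ → ℤ → Fin 2 → ℝ) (φ : ℝ → ℝ), IsHermiteSeq A c ∧ seqNorm (c 0) < ⊤ ∧
    ContDiff ℝ d φ ∧ HermiteTendsto c φ ∧ φ ≠ 0)

end HermiteSubdivision

/-! The Gregory operator kills the samples (p, p') of every polynomial of degree at most d: p(x+1) -
p(x) is the integral of p' over [x, x+1], and integrating the Newton expansion of p' gives Gregory's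
formula, because G_l is the integral of binom(t, l) over [0, 1] (`integral_binomPoly`). Conversely,
a functional that depends on finitely many entries and vanishes on these samples is a local
functional of the Gregory image (`exists_eq_sum_add_gregoryOp`): after subtracting a Newton
interpolant the initial data at index 0 are zero, and the rest is recovered from its Gregory image
by summing differences outward from 0. Spectral order makes S_A preserve the space of samples, so
every coordinate of G S_A factors through G. Equivariance under shifts leaves only two residue
classes of rows, hence a finite mask B.

For convergence put E_n = S_A^n c. Contractivity of S_B gives a Gregory image of size O((ρ/2^d)^n)
with ρ < 1. Since (E_n)_1 should behave like 2^{-n} φ', the scaled difference 2^{(l+1)n} Δ^l (E_n)_1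
should approach the derivative of φ of order l+1. For l = d-1, both its refinement error and its
increments are local functionals of the Gregory image, so it converges to a continuous function.
Lower orders follow by repeated integration, the values at the base point converging by
`IsDecaying.tendsto_initEval`. Finally the second Gregory row equates the divided differences of
(E_n)_0 with the scaled derivative component up to a vanishing error, and one more integration
yields φ. Constant data give a nonzero limit. -/

namespace HermiteSubdivision

open Polynomial

/-! ### Gregory's formula and its exactness on polynomials -/

section Polynomials

theorem fwdDiff_iter_intCast (f : ℝ → ℝ) (l : ℕ) (j : ℤ) :
    (fwdDiff (1 : ℤ))^[l] (fun i : ℤ => f i) j = (fwdDiff (1 : ℝ))^[l] f j := by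
  simp [fwdDiff_iter_eq_sum_shift]

theorem fwdDiff_iter_eval_of_natDegree_le {p : ℝ[X]} {l : ℕ} (h : p.natDegree ≤ l) (x : ℝ) :
    (fwdDiff (1 : ℝ))^[l] p.eval x = l.factorial * p.coeff l := by
  rcases h.lt_or_eq with h | rfl
  · rw [Polynomial.fwdDiff_iter_eq_zero_of_degree_lt h, coeff_eq_zero_of_natDegree_lt h]
    simp
  · rw [Polynomial.fwdDiff_iter_degree_eq_factorial]
    simp [mul_comm]

theorem exists_antiderivative (q : ℝ[X]) :
    ∃ p : ℝ[X], derivative p = q ∧ p.eval 0 = 0 ∧ p.natDegree ≤ q.natDegree + 1 := by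
  refine ⟨∑ i ∈ Finset.range (q.natDegree + 1), monomial (i + 1) (q.coeff i / (i + 1)), ?_, ?_, ?_⟩
  · conv_rhs => rw [q.as_sum_range]
    rw [derivative_sum]
    refine Finset.sum_congr rfl fun i _ => ?_
    rw [derivative_monomial]
    congr 1
    have : (i : ℝ) + 1 ≠ 0 := by positivity
    push_cast
    field_simp
  · simp [eval_finsetSum]
  · refine natDegree_sum_le_of_forall_le _ _ fun i hi => (natDegree_monomial_le _).trans ?_
    have := Finset.mem_range.1 hi
    omega

/-- Multiplication by X - n is the signed Stirling recurrence. This ties the combinatorial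
definition of `gregoryCoeff` to integrals of binomial polynomials. -/
theorem coeff_descPochhammer (n : ℕ) : ∀ j : ℕ,
    (descPochhammer ℝ n).coeff j = (Nat.stirlingFirst n j : ℝ) * (-1) ^ (n - j) := by
  induction n with
  | zero =>
    rintro (_ | j)
    · simp [Nat.stirlingFirst_zero]
    · simp [Nat.stirlingFirst_zero_succ, coeff_one]
  | succ n ih =>
    rintro (_ | j)
    · rw [coeff_zero_eq_eval_zero, descPochhammer_ne_zero_eval_zero _ n.succ_ne_zero]
      simp [Nat.stirlingFirst_succ_zero]
    · rw [descPochhammer_succ_right, mul_sub, coeff_sub, coeff_mul_X, coeff_mul_natCast, ih, ih,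
        Nat.stirlingFirst_succ_succ, Nat.add_sub_add_right]
      -- For n ≤ j the truncated exponent n - (j + 1) is off, but there the Stirling number it
      -- accompanies vanishes.
      rcases lt_or_ge j n with h | h
      · obtain ⟨t, rfl⟩ := Nat.exists_eq_add_of_lt h
        rw [show j + t + 1 - j = t + 1 by omega, show j + t + 1 - (j + 1) = t by omega]
        push_cast
        ring
      · rw [Nat.stirlingFirst_eq_zero_of_lt (show n < j + 1 by omega)]
        simp

/-- The polynomial `x ↦ x (x - 1) ⋯ (x - l + 1) / l!`. -/
noncomputable def binomPoly (l : ℕ) : ℝ[X] := C (1 / (l.factorial : ℝ)) * descPochhammer ℝ l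

theorem natDegree_binomPoly_le (l : ℕ) : (binomPoly l).natDegree ≤ l :=
  (natDegree_C_mul_le _ _).trans (descPochhammer_natDegree ℝ l).le

theorem eval_natCast_binomPoly (l n : ℕ) : (binomPoly l).eval (n : ℝ) = n.choose l := by
  rw [binomPoly, eval_mul, eval_C, Nat.cast_choose_eq_descPochhammer_div]
  ring

theorem integral_binomPoly (l : ℕ) : ∫ t in (0 : ℝ)..1, (binomPoly l).eval t = gregoryCoeff l := by
  have h : ∀ t : ℝ, (binomPoly l).eval t = ∑ j ∈ Finset.range (l + 1),
      (1 / (l.factorial : ℝ)) * ((Nat.stirlingFirst l j : ℝ) * (-1) ^ (l - j)) * t ^ j := by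
    intro t
    rw [binomPoly, eval_mul, eval_C, eval_eq_sum_range, descPochhammer_natDegree, Finset.mul_sum]
    refine Finset.sum_congr rfl fun j _ => ?_
    rw [coeff_descPochhammer]
    ring
  simp_rw [h]
  rw [intervalIntegral.integral_finsetSum
    fun j _ => (by fun_prop : Continuous _).intervalIntegrable _ _]
  rw [gregoryCoeff, Finset.mul_sum]
  refine Finset.sum_congr rfl fun j _ => ?_
  rw [intervalIntegral.integral_const_mul, integral_pow]
  simp
  ring

theorem fwdDiff_iter_binomPoly_zero (l m : ℕ) :
    (fwdDiff (1 : ℝ))^[m] (binomPoly l).eval 0 = if m = l then 1 else 0 := by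
  have h := congrArg (Int.cast : ℤ → ℝ) (fwdDiff_iter_choose_zero l m)
  rw [fwdDiff_iter_eq_sum_shift] at h ⊢
  push_cast at h
  rw [← h]
  refine Finset.sum_congr rfl fun k _ => ?_
  simp [eval_natCast_binomPoly]

/-- Newton's expansion of a polynomial of degree less than `d` around `x`. -/
theorem comp_C_add_X_eq_sum_binomPoly {q : ℝ[X]} {d : ℕ} (hq : q.natDegree < d) (x : ℝ) :
    q.comp (C x + X) =
      ∑ l ∈ Finset.range d, C ((fwdDiff (1 : ℝ))^[l] q.eval x) * binomPoly l := by
  -- Agreement at all natural numbers suffices; there the expansion is the discrete Newton formula.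
  refine eq_of_infinite_eval_eq _ _ ((Set.infinite_range_of_injective
    (Nat.cast_injective (R := ℝ))).mono ?_)
  rintro _ ⟨n, rfl⟩
  simp only [Set.mem_ofPred_eq, eval_comp, eval_add, eval_C, eval_X, eval_finsetSum, eval_mul,
    eval_natCast_binomPoly]
  have h := shift_eq_sum_fwdDiff_iter (1 : ℝ) q.eval n x
  rw [nsmul_eq_mul, mul_one] at h
  rw [h]
  -- The sums over l ≤ n and l < d are compared on a common range: the extra terms vanish through
  -- the binomial coefficient in one, through the degree in the other.
  have h1 : ∀ l ∈ Finset.range (max (n + 1) d), l ∉ Finset.range (n + 1) →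
      n.choose l • (fwdDiff (1 : ℝ))^[l] q.eval x = 0 := fun l _ hl => by
    rw [Nat.choose_eq_zero_of_lt (by simpa using hl), zero_smul]
  have h2 : ∀ l ∈ Finset.range (max (n + 1) d), l ∉ Finset.range d →
      n.choose l • (fwdDiff (1 : ℝ))^[l] q.eval x = 0 := fun l _ hl => by
    rw [Polynomial.fwdDiff_iter_eq_zero_of_degree_lt (hq.trans_le (by simpa using hl))]
    simp
  rw [Finset.sum_subset (Finset.range_mono (le_max_left _ _)) h1,
    ← Finset.sum_subset (Finset.range_mono (le_max_right _ _)) h2]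
  exact Finset.sum_congr rfl fun l _ => by rw [nsmul_eq_mul, mul_comm]

/-- Gregory's formula is exact for polynomials of degree at most `d`. -/
theorem eval_add_one_sub_eval {p : ℝ[X]} {d : ℕ} (hd : 1 ≤ d) (hp : p.natDegree ≤ d) (x : ℝ) :
    p.eval (x + 1) - p.eval x =
      ∑ l ∈ Finset.range d, gregoryCoeff l * (fwdDiff (1 : ℝ))^[l] p.derivative.eval x := by
  have hq : p.derivative.natDegree < d := by
    have := natDegree_derivative_le p
    omega
  have h1 : ∫ t in (0 : ℝ)..1, (p.derivative.comp (C x + X)).eval t = p.eval (x + 1) - p.eval x := by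
    have h := intervalIntegral.integral_eq_sub_of_hasDerivAt (a := 0) (b := 1)
      (f := fun t => (p.comp (C x + X)).eval t)
      (f' := fun t => (p.derivative.comp (C x + X)).eval t)
      (fun t _ => by
        have := (p.comp (C x + X)).hasDerivAt t
        simpa [derivative_comp] using this)
      ((p.derivative.comp (C x + X)).continuous.intervalIntegrable _ _)
    rw [h]
    simp
  rw [← h1, comp_C_add_X_eq_sum_binomPoly hq]
  simp_rw [eval_finsetSum, eval_mul, eval_C]
  rw [intervalIntegral.integral_finsetSum fun l _ =>
    ((binomPoly l).continuous.const_mul _).intervalIntegrable _ _]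
  refine Finset.sum_congr rfl fun l _ => ?_
  rw [intervalIntegral.integral_const_mul, integral_binomPoly, mul_comm]

theorem gregoryOp_polySample {p : ℝ[X]} {d : ℕ} (hd : 1 ≤ d) (hp : p.natDegree ≤ d) :
    gregoryOp d (polySample p) = 0 := by
  have hq : p.derivative.natDegree < d := by
    have := natDegree_derivative_le p
    omega
  funext j a
  fin_cases a
  · simp [gregoryOp, polySample, fwdDiff_iter_intCast (fun x => p.derivative.eval x),
      Polynomial.fwdDiff_iter_eq_zero_of_degree_lt hq]
  · simp [gregoryOp, polySample, fwdDiff_iter_intCast (fun x => p.derivative.eval x), fwdDiff,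
      eval_add_one_sub_eval hd hp]

end Polynomials

end HermiteSubdivision

namespace HermiteSubdivision

open Polynomial

/-! ### Local functionals modulo those of the Gregory operator -/

section LocalFunctionals

/-- Evaluation of one coordinate of a sequence at one index. -/
def coordEval (k : ℤ) (a : Fin 2) : Module.Dual ℝ (ℤ → Fin 2 → ℝ) :=
  LinearMap.proj a ∘ₗ LinearMap.proj k

@[simp] theorem coordEval_apply (k : ℤ) (a : Fin 2) (c : ℤ → Fin 2 → ℝ) :
    coordEval k a c = c k a := rfl

/-- The functionals depending on finitely many entries of a sequence. -/
def localDual : Submodule ℝ (Module.Dual ℝ (ℤ → Fin 2 → ℝ)) :=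
  Submodule.span ℝ (Set.range fun x : ℤ × Fin 2 => coordEval x.1 x.2)

theorem coordEval_mem (k : ℤ) (a : Fin 2) : coordEval k a ∈ localDual :=
  Submodule.subset_span ⟨(k, a), rfl⟩

theorem exists_bound_of_mem_localDual {f : Module.Dual ℝ (ℤ → Fin 2 → ℝ)} (hf : f ∈ localDual) :
    ∃ C : ℝ, 0 ≤ C ∧ ∀ c M, (∀ k, ‖c k‖ ≤ M) → |f c| ≤ C * M := by
  induction hf using Submodule.span_induction with
  | mem f hf =>
    obtain ⟨x, rfl⟩ := hf
    exact ⟨1, zero_le_one, fun c M h => by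
      simpa using (norm_le_pi_norm (c x.1) x.2).trans (h x.1)⟩
  | zero => exact ⟨0, le_rfl, by simp⟩
  | add f g _ _ hf hg =>
    obtain ⟨C, hC, hf⟩ := hf
    obtain ⟨C', hC', hg⟩ := hg
    refine ⟨C + C', add_nonneg hC hC', fun c M h => ?_⟩
    rw [LinearMap.add_apply, add_mul]
    exact (abs_add_le _ _).trans (add_le_add (hf c M h) (hg c M h))
  | smul a f _ hf =>
    obtain ⟨C, hC, hf⟩ := hf
    refine ⟨|a| * C, by positivity, fun c M h => ?_⟩
    rw [LinearMap.smul_apply, smul_eq_mul, abs_mul, mul_assoc]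
    exact mul_le_mul_of_nonneg_left (hf c M h) (abs_nonneg a)

theorem comp_mem_localDual {T : (ℤ → Fin 2 → ℝ) →ₗ[ℝ] (ℤ → Fin 2 → ℝ)}
    (hT : ∀ k a, coordEval k a ∘ₗ T ∈ localDual)
    {f : Module.Dual ℝ (ℤ → Fin 2 → ℝ)} (hf : f ∈ localDual) : f ∘ₗ T ∈ localDual := by
  induction hf using Submodule.span_induction with
  | mem f hf =>
    obtain ⟨x, rfl⟩ := hf
    exact hT _ _
  | zero => simp
  | add f g _ _ hf hg => rw [LinearMap.add_comp]; exact add_mem hf hg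
  | smul a f _ hf => rw [LinearMap.smul_comp]; exact Submodule.smul_mem _ _ hf

/-- The forward difference of real sequences as a linear map. -/
def fwdDiffLin : Module.End ℝ (ℤ → ℝ) where
  toFun := fwdDiff 1
  map_add' := fwdDiff_add 1
  map_smul' := fwdDiff_const_smul 1

theorem fwdDiffLin_pow_apply (l : ℕ) (f : ℤ → ℝ) : (fwdDiffLin ^ l) f = (fwdDiff 1)^[l] f := by
  rw [Module.End.pow_apply]
  rfl

/-- The functional `c ↦ (Δ^l c_a)(k)`. -/
def diffEval (l : ℕ) (k : ℤ) (a : Fin 2) : Module.Dual ℝ (ℤ → Fin 2 → ℝ) :=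
  LinearMap.proj k ∘ₗ (fwdDiffLin ^ l) ∘ₗ
    (LinearMap.pi fun i => coordEval i a : (ℤ → Fin 2 → ℝ) →ₗ[ℝ] (ℤ → ℝ))

theorem diffEval_apply (l : ℕ) (k : ℤ) (a : Fin 2) (c : ℤ → Fin 2 → ℝ) :
    diffEval l k a c = (fwdDiff (1 : ℤ))^[l] (fun i => c i a) k := by
  simp only [diffEval, LinearMap.comp_apply, fwdDiffLin_pow_apply]
  rfl

theorem diffEval_zero (k : ℤ) (a : Fin 2) : diffEval 0 k a = coordEval k a := by
  ext c
  simp [diffEval_apply]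

theorem diffEval_succ (l : ℕ) (k : ℤ) (a : Fin 2) :
    diffEval (l + 1) k a = diffEval l (k + 1) a - diffEval l k a := by
  refine LinearMap.ext fun c => ?_
  simp only [diffEval_apply, Function.iterate_succ_apply', LinearMap.sub_apply, fwdDiff]

theorem diffEval_mem (l : ℕ) (k : ℤ) (a : Fin 2) : diffEval l k a ∈ localDual := by
  induction l generalizing k with
  | zero => rw [diffEval_zero]; exact coordEval_mem k a
  | succ l ih => rw [diffEval_succ]; exact sub_mem (ih _) (ih _)

theorem diffEval_shift (l : ℕ) (k m : ℤ) (a : Fin 2) (c : ℤ → Fin 2 → ℝ) :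
    diffEval l k a (fun i => c (i + m)) = diffEval l (k + m) a c := by
  simp only [diffEval_apply]
  exact fwdDiff_iter_comp_add 1 (fun i => c i a) m l k

theorem gregoryOp_apply_zero (d : ℕ) (c : ℤ → Fin 2 → ℝ) (j : ℤ) :
    gregoryOp d c j 0 = diffEval d j 1 c := by
  simp [gregoryOp, diffEval_apply]

theorem gregoryOp_apply_one (d : ℕ) (c : ℤ → Fin 2 → ℝ) (j : ℤ) :
    gregoryOp d c j 1 =
      diffEval 1 j 0 c - ∑ l ∈ Finset.range d, gregoryCoeff l * diffEval l j 1 c := by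
  simp [gregoryOp, diffEval_apply]

/-- The Gregory operator as a linear map. -/
noncomputable def gregoryLin (d : ℕ) : (ℤ → Fin 2 → ℝ) →ₗ[ℝ] (ℤ → Fin 2 → ℝ) where
  toFun := gregoryOp d
  map_add' c c' := by
    funext j a
    fin_cases a
    · simp [gregoryOp_apply_zero]
    · simp [gregoryOp_apply_one, mul_add, Finset.sum_add_distrib]
      ring
  map_smul' r c := by
    funext j a
    fin_cases a
    · simp [gregoryOp_apply_zero]
    · simp [gregoryOp_apply_one, mul_sub, Finset.mul_sum, mul_left_comm]

@[simp] theorem gregoryLin_apply (d : ℕ) (c : ℤ → Fin 2 → ℝ) : gregoryLin d c = gregoryOp d c := rfl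

theorem coordEval_zero_comp_gregoryLin (d : ℕ) (j : ℤ) :
    coordEval j 0 ∘ₗ gregoryLin d = diffEval d j 1 :=
  LinearMap.ext fun c => gregoryOp_apply_zero d c j

theorem coordEval_one_comp_gregoryLin (d : ℕ) (j : ℤ) :
    coordEval j 1 ∘ₗ gregoryLin d =
      diffEval 1 j 0 - ∑ l ∈ Finset.range d, gregoryCoeff l • diffEval l j 1 :=
  LinearMap.ext fun c => by
    simpa using gregoryOp_apply_one d c j

theorem coordEval_comp_gregoryLin_mem (d : ℕ) (j : ℤ) (a : Fin 2) :
    coordEval j a ∘ₗ gregoryLin d ∈ localDual := by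
  fin_cases a
  · exact (coordEval_zero_comp_gregoryLin d j).symm ▸ diffEval_mem _ _ _
  · exact (coordEval_one_comp_gregoryLin d j).symm ▸ sub_mem (diffEval_mem _ _ _)
      (Submodule.sum_mem _ fun l _ => Submodule.smul_mem _ _ (diffEval_mem _ _ _))

theorem gregoryOp_shift (d : ℕ) (c : ℤ → Fin 2 → ℝ) (m : ℤ) :
    gregoryOp d (fun i => c (i + m)) = fun j => gregoryOp d c (j + m) := by
  funext j a
  fin_cases a
  · simp [gregoryOp_apply_zero, diffEval_shift]
  · simp [gregoryOp_apply_one, diffEval_shift]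

/-- The sampling map of polynomials as a linear map. -/
noncomputable def polySampleLin : ℝ[X] →ₗ[ℝ] (ℤ → Fin 2 → ℝ) where
  toFun := polySample
  map_add' p q := by
    funext j a
    fin_cases a <;> simp [polySample]
  map_smul' r p := by
    funext j a
    fin_cases a <;> simp [polySample]

@[simp] theorem polySampleLin_apply (p : ℝ[X]) : polySampleLin p = polySample p := rfl

theorem diffEval_polySample {p : ℝ[X]} {m : ℕ} (hp : p.natDegree ≤ m + 1) (k : ℤ) :
    diffEval m k 1 (polySample p) = (m + 1).factorial * p.coeff (m + 1) := by
  have hq : p.derivative.natDegree ≤ m := by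
    have := natDegree_derivative_le p
    omega
  rw [diffEval_apply]
  simp only [polySample, Matrix.cons_val_one, Matrix.cons_val_fin_one]
  rw [fwdDiff_iter_intCast (fun x => p.derivative.eval x),
    fwdDiff_iter_eval_of_natDegree_le hq, coeff_derivative, Nat.factorial_succ]
  push_cast
  ring

/-- The functionals `c ↦ c₀(0)` and `c ↦ (Δ^m c₁)(0)`, for `m = 0, 1, …`. -/
def initEval : ℕ → Module.Dual ℝ (ℤ → Fin 2 → ℝ)
  | 0 => coordEval 0 0
  | m + 1 => diffEval m 0 1

theorem initEval_mem : ∀ m : ℕ, initEval m ∈ localDual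
  | 0 => coordEval_mem _ _
  | _ + 1 => diffEval_mem _ _ _

/-- Differentiation lowers the degree by one, so the m-th difference of the derivative component
detects degree m + 1; hence the shifted index in `initEval`. -/
theorem initEval_polySample {p : ℝ[X]} {m : ℕ} (hp : p.natDegree ≤ m) :
    initEval m (polySample p) = m.factorial * p.coeff m := by
  cases m with
  | zero => simp [initEval, polySample, coeff_zero_eq_eval_zero]
  | succ m => exact diffEval_polySample hp 0

/-- Polynomials dual to the functionals `initEval`. -/
theorem exists_dual_polynomials : ∃ N : ℕ → ℝ[X], ∀ k, (N k).natDegree ≤ k ∧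
    ∀ m, initEval m (polySample (N k)) = if m = k then 1 else 0 := by
  have key : ∀ k, ∃ p : ℝ[X], p.natDegree ≤ k ∧
      ∀ m, initEval m (polySample p) = if m = k then 1 else 0 := by
    intro k
    cases k with
    | zero =>
      refine ⟨1, by simp, fun m => ?_⟩
      cases m with
      | zero => simp [initEval, polySample]
      | succ m =>
        rw [initEval, diffEval_polySample (by simp)]
        simp [coeff_one]
    | succ k =>
      -- Differences of binomial polynomials at 0 are Kronecker deltas, and the antiderivative
      -- vanishing at 0 also satisfies the condition for `initEval 0`.
      obtain ⟨p, hp, hp0, hdeg⟩ := exists_antiderivative (binomPoly k)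
      refine ⟨p, hdeg.trans (Nat.succ_le_succ (natDegree_binomPoly_le k)), fun m => ?_⟩
      cases m with
      | zero => simp [initEval, polySample, hp0]
      | succ m =>
        rw [initEval, diffEval_apply]
        simp only [polySample, Matrix.cons_val_one, Matrix.cons_val_fin_one, hp]
        rw [fwdDiff_iter_intCast (fun x => (binomPoly k).eval x), Int.cast_zero,
          fwdDiff_iter_binomPoly_zero]
        simp
  choose N hN using key
  exact ⟨N, hN⟩

/-- The sequences killed by all `initEval m`, `m ≤ d`. -/
def initKernel (d : ℕ) : Submodule ℝ (ℤ → Fin 2 → ℝ) :=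
  ⨅ m ∈ Finset.range (d + 1), LinearMap.ker (initEval m)

theorem mem_initKernel {d : ℕ} {c : ℤ → Fin 2 → ℝ} :
    c ∈ initKernel d ↔ ∀ m ≤ d, initEval m c = 0 := by
  simp [initKernel, Submodule.mem_iInf]

/-- The functionals on `initKernel d` that are local functionals of the Gregory operator. -/
noncomputable def gregoryDual (d : ℕ) : Submodule ℝ (Module.Dual ℝ (initKernel d)) :=
  localDual.map (gregoryLin d ∘ₗ (initKernel d).subtype).dualMap

/-- The restriction of functionals to `initKernel d`. -/
noncomputable def initRestrict (d : ℕ) :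
    Module.Dual ℝ (ℤ → Fin 2 → ℝ) →ₗ[ℝ] Module.Dual ℝ (initKernel d) :=
  (initKernel d).subtype.dualMap

/-- Telescoping from index 0 in either direction reaches k in finitely many steps, so locality
survives. -/
theorem initRestrict_diffEval_mem {d l : ℕ} {a : Fin 2}
    (h0 : initRestrict d (diffEval l 0 a) = 0)
    (h : ∀ k, initRestrict d (diffEval (l + 1) k a) ∈ gregoryDual d) (k : ℤ) :
    initRestrict d (diffEval l k a) ∈ gregoryDual d := by
  have hs : ∀ k, initRestrict d (diffEval l (k + 1) a) =
      initRestrict d (diffEval (l + 1) k a) + initRestrict d (diffEval l k a) := fun k => by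
    rw [diffEval_succ, map_sub, sub_add_cancel]
  induction k using Int.induction_on with
  | zero => rw [h0]; exact zero_mem _
  | succ k ih => rw [hs]; exact add_mem (h _) ih
  | pred k ih =>
    have := hs (-(k : ℤ) - 1)
    rw [sub_add_cancel] at this
    rw [eq_sub_of_add_eq' this.symm]
    exact sub_mem ih (h _)

/-- The first Gregory row is Δ^d c₁; with zero initial data, repeated summation recovers all lower
differences of c₁. The second row then yields Δ c₀, and a last summation yields c₀. -/
theorem initRestrict_coordEval_mem (d : ℕ) (k : ℤ) (a : Fin 2) :
    initRestrict d (coordEval k a) ∈ gregoryDual d := by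
  have hg : ∀ k a, initRestrict d (coordEval k a ∘ₗ gregoryLin d) ∈ gregoryDual d := fun k a =>
    ⟨coordEval k a, coordEval_mem k a, rfl⟩
  have h0 : ∀ m ≤ d, initRestrict d (initEval m) = 0 := fun m hm =>
    LinearMap.ext fun c => mem_initKernel.1 c.2 m hm
  -- Descending induction on the order of the difference, from d to 0.
  have h1 : ∀ i ≤ d, ∀ k, initRestrict d (diffEval (d - i) k 1) ∈ gregoryDual d := by
    intro i
    induction i with
    | zero => exact fun _ k => coordEval_zero_comp_gregoryLin d k ▸ hg k 0
    | succ i ih =>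
      intro hi k
      refine initRestrict_diffEval_mem (h0 (d - (i + 1) + 1) (by omega)) (fun k => ?_) k
      rw [show d - (i + 1) + 1 = d - i by omega]
      exact ih (by omega) k
  have h1' : ∀ l ≤ d, ∀ k, initRestrict d (diffEval l k 1) ∈ gregoryDual d := fun l hl k => by
    have := h1 (d - l) (by omega) k
    rwa [show d - (d - l) = l by omega] at this
  fin_cases a
  · refine diffEval_zero k 0 ▸ initRestrict_diffEval_mem ?_ (fun k => ?_) k
    · rw [diffEval_zero]
      exact h0 0 (by omega)
    · have := hg k 1
      rw [coordEval_one_comp_gregoryLin, map_sub, map_sum] at this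
      rw [← sub_add_cancel (initRestrict d (diffEval (0 + 1) k 0))
        (∑ l ∈ Finset.range d, initRestrict d (gregoryCoeff l • diffEval l k 1))]
      refine add_mem this (Submodule.sum_mem _ fun l hl => ?_)
      rw [map_smul]
      exact Submodule.smul_mem _ _ (h1' l (Finset.mem_range.1 hl).le k)
  · exact diffEval_zero k 1 ▸ h1' 0 (by omega) k

/-- A local functional is determined by its values on the dual polynomials up to a local functional
of the Gregory operator. -/
theorem exists_eq_sum_add_gregoryOp {d : ℕ} (hd : 1 ≤ d) {N : ℕ → ℝ[X]}
    (hN : ∀ k, (N k).natDegree ≤ k ∧ ∀ m, initEval m (polySample (N k)) = if m = k then 1 else 0)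
    {f : Module.Dual ℝ (ℤ → Fin 2 → ℝ)} (hf : f ∈ localDual) :
    ∃ g ∈ localDual, ∀ c, f c =
      ∑ k ∈ Finset.range (d + 1), f (polySample (N k)) * initEval k c + g (gregoryOp d c) := by
  have hmem : initRestrict d f ∈ gregoryDual d := by
    induction hf using Submodule.span_induction with
    | mem f hf =>
      obtain ⟨x, rfl⟩ := hf
      exact initRestrict_coordEval_mem d _ _
    | zero => simp
    | add f g _ _ hf hg => rw [map_add]; exact add_mem hf hg
    | smul a f _ hf => rw [map_smul]; exact Submodule.smul_mem _ _ hf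
  obtain ⟨g, hg, hgf⟩ := hmem
  refine ⟨g, hg, fun c => ?_⟩
  -- The interpolant shares the initial data of c and is invisible to the Gregory operator.
  set s := ∑ k ∈ Finset.range (d + 1), initEval k c • polySample (N k) with hs
  have hker : c - s ∈ initKernel d := by
    refine mem_initKernel.2 fun m hm => ?_
    rw [map_sub, hs, map_sum]
    simp_rw [map_smul, (hN _).2 m]
    simp [hm]
  have hG : gregoryOp d (c - s) = gregoryOp d c := by
    rw [← gregoryLin_apply, map_sub, hs, map_sum, Finset.sum_eq_zero, sub_zero, gregoryLin_apply]
    intro k hk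
    rw [map_smul, gregoryLin_apply, gregoryOp_polySample hd, smul_zero]
    exact (hN k).1.trans (Nat.lt_succ_iff.1 (Finset.mem_range.1 hk))
  have h := LinearMap.congr_fun hgf ⟨c - s, hker⟩
  have h' : g (gregoryOp d (c - s)) = f (c - s) := h
  rw [← hG, h', map_sub, hs, map_sum]
  simp_rw [map_smul, smul_eq_mul, mul_comm]
  ring

end LocalFunctionals

end HermiteSubdivision

namespace HermiteSubdivision

open Polynomial

/-! ### Subdivision operators and the Gregory factorization -/

section Subdivision

variable (A : ℤ →₀ Matrix (Fin 2) (Fin 2) ℝ)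

theorem subdivOp_eq_sum (c : ℤ → Fin 2 → ℝ) (j : ℤ) :
    subdivOp A c j =
      ∑ k ∈ A.support.image (fun m => (j - m) / 2), (A (j - 2 * k)).mulVec (c k) := by
  refine finsum_eq_sum_of_support_subset _ fun k hk => ?_
  have hA : A (j - 2 * k) ≠ 0 := fun h => hk (by simp [h])
  exact Finset.mem_coe.2 (Finset.mem_image.2
    ⟨j - 2 * k, Finsupp.mem_support_iff.2 hA, by omega⟩)

/-- The subdivision operator as a linear map. -/
noncomputable def subdivLin : (ℤ → Fin 2 → ℝ) →ₗ[ℝ] (ℤ → Fin 2 → ℝ) where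
  toFun := subdivOp A
  map_add' c c' := by
    funext j
    simp only [subdivOp_eq_sum, Pi.add_apply, Matrix.mulVec_add, Finset.sum_add_distrib]
  map_smul' r c := by
    funext j
    simp [subdivOp_eq_sum, Matrix.mulVec_smul, Finset.smul_sum]

@[simp] theorem subdivLin_apply (c : ℤ → Fin 2 → ℝ) : subdivLin A c = subdivOp A c := rfl

theorem coordEval_comp_subdivLin (j : ℤ) (a : Fin 2) :
    coordEval j a ∘ₗ subdivLin A = ∑ k ∈ A.support.image (fun m => (j - m) / 2),
      ∑ b, A (j - 2 * k) a b • coordEval k b := by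
  refine LinearMap.ext fun c => ?_
  simp only [LinearMap.comp_apply, subdivLin_apply, coordEval_apply, subdivOp_eq_sum, Matrix.mulVec,
    dotProduct, LinearMap.sum_apply, LinearMap.smul_apply, Finset.sum_apply, smul_eq_mul]

theorem coordEval_comp_subdivLin_mem (j : ℤ) (a : Fin 2) :
    coordEval j a ∘ₗ subdivLin A ∈ localDual := by
  rw [coordEval_comp_subdivLin]
  exact Submodule.sum_mem _ fun k _ => Submodule.sum_mem _ fun b _ =>
    Submodule.smul_mem _ _ (coordEval_mem k b)

theorem subdivOp_shift (c : ℤ → Fin 2 → ℝ) (j m : ℤ) :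
    subdivOp A (fun i => c (i + m)) j = subdivOp A c (j + 2 * m) := by
  unfold subdivOp
  rw [← finsum_comp_equiv (Equiv.addRight m) (f := fun k => (A (j + 2 * m - 2 * k)).mulVec (c k))]
  refine finsum_congr fun k => ?_
  simp only [Equiv.coe_addRight]
  congr 2
  ring

/-- The spectral polynomials have exact degrees 0, …, d, so S_A is triangular on samples with
diagonal 2^{-m}. The leading coefficient is what makes the error functionals in the convergence
proof vanish on polynomials. -/
theorem HasSpectralOrder.exists_polySample {A : ℤ →₀ Matrix (Fin 2) (Fin 2) ℝ} {d : ℕ}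
    (hA : HasSpectralOrder A d) {m : ℕ} (hm : m ≤ d) (p : ℝ[X]) (hp : p.natDegree ≤ m) :
    ∃ q : ℝ[X], q.natDegree ≤ m ∧ q.coeff m = (1 / 2) ^ m * p.coeff m ∧
      subdivOp A (polySample p) = polySample q := by
  obtain ⟨P, hP⟩ := hA
  induction m generalizing p with
  | zero =>
    obtain ⟨h1, h2, h3⟩ := hP 0 (by omega)
    have hP0 : P 0 = 1 := by
      rw [eq_C_of_natDegree_le_zero h1, h2]
      simp
    refine ⟨p, hp, by simp, ?_⟩
    rw [hP0, pow_zero, one_smul] at h3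
    have : p = p.coeff 0 • (1 : ℝ[X]) := by
      conv_lhs => rw [eq_C_of_natDegree_le_zero hp]
      rw [smul_eq_C_mul, mul_one]
    rw [this, ← polySampleLin_apply, map_smul, ← subdivLin_apply, map_smul, polySampleLin_apply,
      subdivLin_apply, h3]
  | succ m ih =>
    obtain ⟨h1, h2, h3⟩ := hP (m + 1) hm
    have hf : ((m + 1).factorial : ℝ) ≠ 0 := by positivity
    set a := p.coeff (m + 1) * (m + 1).factorial with ha
    have hc : (p - a • P (m + 1)).coeff (m + 1) = 0 := by
      rw [coeff_sub, coeff_smul, h2, ha, smul_eq_mul]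
      field_simp
      ring
    have hdeg : (p - a • P (m + 1)).natDegree ≤ m := by
      refine natDegree_le_iff_coeff_eq_zero.2 fun i hi => ?_
      rcases (Nat.succ_le_of_lt hi).eq_or_lt with h | h
      · rw [← h]
        exact hc
      · rw [coeff_sub, coeff_smul, coeff_eq_zero_of_natDegree_lt (hp.trans_lt h),
          coeff_eq_zero_of_natDegree_lt (h1.trans_lt h)]
        simp
    obtain ⟨q, hq1, -, hq3⟩ := ih (by omega) _ hdeg
    refine ⟨q + (a * (1 / 2) ^ (m + 1)) • P (m + 1), ?_, ?_, ?_⟩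
    · exact natDegree_add_le_of_degree_le (hq1.trans m.le_succ) ((natDegree_smul_le _ _).trans h1)
    · rw [coeff_add, coeff_smul, coeff_eq_zero_of_natDegree_lt (Nat.lt_succ_of_le hq1), h2, ha,
        smul_eq_mul]
      field_simp
      ring
    · rw [← polySampleLin_apply, map_sub, map_smul, ← subdivLin_apply, map_sub, map_smul,
        subdivLin_apply, subdivLin_apply, polySampleLin_apply, polySampleLin_apply, h3, sub_eq_iff_eq_add] at hq3
      rw [← subdivLin_apply, ← polySampleLin_apply, ← polySampleLin_apply, map_add, map_smul]
      simp only [subdivLin_apply, polySampleLin_apply]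
      rw [hq3, smul_smul]

theorem exists_finsupp_of_mem_localDual {f : Module.Dual ℝ (ℤ → Fin 2 → ℝ)} (hf : f ∈ localDual) :
    ∃ v : ℤ → Fin 2 → ℝ, ∃ s : Finset ℤ, (∀ k ∉ s, v k = 0) ∧
      ∀ c, f c = ∑ᶠ k, ∑ b, v k b * c k b := by
  obtain ⟨w, rfl⟩ := (Finsupp.mem_span_range_iff_exists_finsupp).1 hf
  refine ⟨fun k b => w (k, b), w.support.image Prod.fst, fun k hk => ?_, fun c => ?_⟩
  · funext b
    by_contra h
    exact hk (Finset.mem_image.2 ⟨(k, b), Finsupp.mem_support_iff.2 h, rfl⟩)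
  · rw [finsum_eq_sum_of_support_subset (s := w.support.image Prod.fst)]
    · rw [← Finset.sum_product', Finsupp.sum, LinearMap.sum_apply]
      refine Finset.sum_subset_zero_on_sdiff (fun x hx => ?_) (fun x hx => ?_) fun x _ => ?_
      · exact Finset.mem_product.2 ⟨Finset.mem_image_of_mem _ hx, Finset.mem_univ _⟩
      · simp [Finsupp.notMem_support_iff.1 (Finset.mem_sdiff.1 hx).2]
      · simp
    · intro k hk
      by_contra h
      refine hk (Finset.sum_eq_zero fun b _ => ?_)
      have : w (k, b) = 0 := by
        by_contra h'
        exact h (Finset.mem_coe.2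
          (Finset.mem_image.2 ⟨(k, b), Finsupp.mem_support_iff.2 h', rfl⟩))
      simp [this]

/-- A `2`-shift equivariant operator given by local functionals is a subdivision operator. -/
theorem exists_subdivOp_eq {g : ℤ → Fin 2 → Module.Dual ℝ (ℤ → Fin 2 → ℝ)}
    (hg : ∀ j a, g j a ∈ localDual) :
    ∃ B : ℤ →₀ Matrix (Fin 2) (Fin 2) ℝ, ∀ c (j : ℤ) a,
      subdivOp B c j a = g (j % 2) a (fun i => c (i + j / 2)) := by
  choose v s hs hv using fun j a => exists_finsupp_of_mem_localDual (hg j a)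
  -- For m = j - 2k with j in {0, 1}, the row is j = m % 2 and the column is k = -(m / 2).
  have hfin : (Function.support fun m : ℤ =>
      (Matrix.of fun a b => v (m % 2) a (-(m / 2)) b : Matrix (Fin 2) (Fin 2) ℝ)).Finite := by
    refine (((Finset.univ : Finset (Fin 2)).biUnion fun a =>
      (s 0 a).image (fun k => -2 * k) ∪ (s 1 a).image (fun k => 1 - 2 * k)).finite_toSet).subset ?_
    intro m hm
    by_contra h
    refine hm (Matrix.ext fun a b => ?_)
    simp only [Matrix.of_apply, Matrix.zero_apply]
    refine congrFun (hs _ _ _ fun hk => h ?_) b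
    refine Finset.mem_coe.2 (Finset.mem_biUnion.2 ⟨a, Finset.mem_univ _, Finset.mem_union.2 ?_⟩)
    rcases Int.emod_two_eq_zero_or_one m with h2 | h2
    · exact Or.inl (Finset.mem_image.2 ⟨_, h2 ▸ hk, by omega⟩)
    · exact Or.inr (Finset.mem_image.2 ⟨_, h2 ▸ hk, by omega⟩)
  refine ⟨Finsupp.ofSupportFinite _ hfin, fun c j a => ?_⟩
  have h1 : subdivOp (Finsupp.ofSupportFinite _ hfin) c j =
      subdivOp (Finsupp.ofSupportFinite _ hfin) (fun i => c (i + j / 2)) (j % 2) := by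
    rw [subdivOp_shift]
    congr 1
    omega
  rw [h1]
  generalize (fun i => c (i + j / 2)) = c'
  rw [hv]
  have hj := Int.emod_two_eq_zero_or_one j
  have h2 : ∀ k : ℤ, ((Finsupp.ofSupportFinite _ hfin) (j % 2 - 2 * k)).mulVec (c' k) =
      fun a => ∑ b, v (j % 2) a k b * c' k b := fun k => by
    funext a
    simp only [Finsupp.ofSupportFinite_coe, Matrix.mulVec, dotProduct, Matrix.of_apply]
    rw [show (j % 2 - 2 * k) % 2 = j % 2 by omega, show -((j % 2 - 2 * k) / 2) = k by omega]
  unfold subdivOp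
  simp_rw [h2]
  have hsub : (Function.support fun k => (fun a => ∑ b, v (j % 2) a k b * c' k b : Fin 2 → ℝ)) ⊆
      ((Finset.univ : Finset (Fin 2)).biUnion (s (j % 2)) : Finset ℤ) := by
    intro k hk
    by_contra h
    refine hk (funext fun a => Finset.sum_eq_zero fun b _ => ?_)
    rw [hs _ a k fun h' => h (Finset.mem_coe.2
      (Finset.mem_biUnion.2 ⟨a, Finset.mem_univ _, h'⟩))]
    simp
  rw [finsum_eq_sum_of_support_subset _ hsub, finsum_eq_sum_of_support_subset, Finset.sum_apply]
  intro k hk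
  exact hsub fun h => hk (congrFun h a)

theorem HasSpectralOrder.exists_gregory_factorization {A : ℤ →₀ Matrix (Fin 2) (Fin 2) ℝ} {d : ℕ}
    (hd : 1 ≤ d) (hA : HasSpectralOrder A d) :
    ∃ B : ℤ →₀ Matrix (Fin 2) (Fin 2) ℝ, ∀ c : ℤ → Fin 2 → ℝ,
      gregoryOp d (subdivOp A c) = ((1 / 2 : ℝ) ^ d) • subdivOp B (gregoryOp d c) := by
  obtain ⟨N, hN⟩ := exists_dual_polynomials
  have key : ∀ (j : ℤ) (a : Fin 2), ∃ g ∈ localDual, ∀ c,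
      gregoryOp d (subdivOp A c) j a = g (gregoryOp d c) := by
    intro j a
    obtain ⟨g, hg, h⟩ := exists_eq_sum_add_gregoryOp hd hN
      (comp_mem_localDual (coordEval_comp_subdivLin_mem A) (coordEval_comp_gregoryLin_mem d j a))
    refine ⟨g, hg, fun c => (h c).trans ?_⟩
    rw [Finset.sum_eq_zero, zero_add]
    intro k hk
    have hk : k ≤ d := Nat.lt_succ_iff.1 (Finset.mem_range.1 hk)
    obtain ⟨q, hq, -, hq'⟩ := hA.exists_polySample hk _ (hN k).1
    simp [hq', gregoryOp_polySample hd (hq.trans hk)]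
  choose g hg h using key
  -- The factor 2^d offsets the 2^{-d} in front of S_B.
  obtain ⟨B, hB⟩ := exists_subdivOp_eq (g := fun j a => (2 : ℝ) ^ d • g j a)
    fun j a => Submodule.smul_mem _ _ (hg j a)
  refine ⟨B, fun c => ?_⟩
  funext j a
  have h1 : gregoryOp d (subdivOp A c) j a =
      gregoryOp d (subdivOp A fun i => c (i + j / 2)) (j % 2) a := by
    rw [show (subdivOp A fun i => c (i + j / 2)) = fun i => subdivOp A c (i + 2 * (j / 2)) from
      funext fun i => subdivOp_shift A c i _, gregoryOp_shift]
    exact congrArg (fun i => gregoryOp d (subdivOp A c) i a)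
      (show j = j % 2 + 2 * (j / 2) by omega)
  rw [h1, h, gregoryOp_shift, Pi.smul_apply, Pi.smul_apply, hB, LinearMap.smul_apply,
    smul_eq_mul, smul_eq_mul, ← mul_assoc, ← mul_pow]
  norm_num

/-- Uniform bounds for `2`-shift equivariant families of functionals. -/
theorem exists_uniform_bound {f : ℤ → Module.Dual ℝ (ℤ → Fin 2 → ℝ)}
    {T : (ℤ → Fin 2 → ℝ) → (ℤ → Fin 2 → ℝ)}
    (hshift : ∀ c (j m : ℤ), f j (fun i => c (i + m)) = f (j + 2 * m) c)
    (hT : ∀ c (m : ℤ), T (fun i => c (i + m)) = fun i => T c (i + m))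
    (hf : ∀ j, ∃ g ∈ localDual, ∀ c, f j c = g (T c)) :
    ∃ C : ℝ, 0 ≤ C ∧ ∀ c M, (∀ k, ‖T c k‖ ≤ M) → ∀ j, |f j c| ≤ C * M := by
  choose g hg hfg using hf
  choose C hC hgC using fun j => exists_bound_of_mem_localDual (hg j)
  refine ⟨max (C 0) (C 1), (hC 0).trans (le_max_left _ _), fun c M hM j => ?_⟩
  have hM0 : 0 ≤ M := (norm_nonneg _).trans (hM 0)
  have hj : f j c = f (j % 2) (fun i => c (i + j / 2)) := by
    rw [hshift]
    exact congrArg (fun i => f i c) (show j = j % 2 + 2 * (j / 2) by omega)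
  rw [hj, hfg, hT]
  refine (hgC _ _ M fun k => hM _).trans (mul_le_mul_of_nonneg_right ?_ hM0)
  rcases Int.emod_two_eq_zero_or_one j with h | h <;> rw [h]
  · exact le_max_left _ _
  · exact le_max_right _ _

theorem exists_norm_subdivOp_le :
    ∃ K : ℝ, 0 ≤ K ∧ ∀ c M, (∀ k, ‖c k‖ ≤ M) → ∀ j, ‖subdivOp A c j‖ ≤ K * M := by
  have h : ∀ a : Fin 2, ∃ C : ℝ, 0 ≤ C ∧ ∀ c M, (∀ k, ‖c k‖ ≤ M) →
      ∀ j : ℤ, |(coordEval j a ∘ₗ subdivLin A) c| ≤ C * M := fun a =>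
    exists_uniform_bound (T := id) (fun c j m => by simp [subdivOp_shift]) (fun c m => rfl)
      fun j => ⟨_, coordEval_comp_subdivLin_mem A j a, fun c => rfl⟩
  choose C hC h using h
  refine ⟨max (C 0) (C 1), (hC 0).trans (le_max_left _ _), fun c M hM j => ?_⟩
  have hM0 : 0 ≤ M := (norm_nonneg _).trans (hM 0)
  refine (pi_norm_le_iff_of_nonneg (mul_nonneg ((hC 0).trans (le_max_left _ _)) hM0)).2 fun a => ?_
  refine (h a c M hM j).trans (mul_le_mul_of_nonneg_right ?_ hM0)
  fin_cases a
  · exact le_max_left _ _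
  · exact le_max_right _ _

end Subdivision

/-! ### Geometric decay from contractivity -/

section Contractivity

theorem seqNorm_le_iff {c : ℤ → Fin 2 → ℝ} {M : ℝ} (hM : 0 ≤ M) :
    seqNorm c ≤ ENNReal.ofReal M ↔ ∀ k, ‖c k‖ ≤ M := by
  rw [seqNorm, iSup_le_iff]
  refine forall_congr' fun k => ?_
  rw [← ofReal_norm, ENNReal.ofReal_le_ofReal_iff hM]

/-- `opNorm` tests only sequences of norm exactly 1, so c is divided by its true supremum s, not by
the bound M; the case s = 0 is separate. -/
theorem norm_le_of_opNorm_le {T : (ℤ → Fin 2 → ℝ) →ₗ[ℝ] (ℤ → Fin 2 → ℝ)} {q : ℝ} (hq : 0 ≤ q)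
    (hT : opNorm T ≤ ENNReal.ofReal q) {c : ℤ → Fin 2 → ℝ} {M : ℝ} (hM : ∀ k, ‖c k‖ ≤ M) (j : ℤ) :
    ‖T c j‖ ≤ q * M := by
  have hM0 : 0 ≤ M := (norm_nonneg _).trans (hM 0)
  have hbdd : BddAbove (Set.range fun k => ‖c k‖) := ⟨M, by rintro _ ⟨k, rfl⟩; exact hM k⟩
  set s := ⨆ k, ‖c k‖ with hs
  have hcs : ∀ k, ‖c k‖ ≤ s := fun k => le_ciSup hbdd k
  have hsM : s ≤ M := ciSup_le hM
  have hs0 : 0 ≤ s := (norm_nonneg _).trans (hcs 0)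
  rcases hs0.eq_or_lt with h0 | hpos
  · have : c = 0 := funext fun k => norm_le_zero_iff.1 (h0 ▸ hcs k)
    rw [this, map_zero]
    simpa using mul_nonneg hq hM0
  · have hnorm : seqNorm (s⁻¹ • c) = 1 := by
      refine le_antisymm ?_ ?_
      · rw [← ENNReal.ofReal_one, seqNorm_le_iff zero_le_one]
        intro k
        rw [Pi.smul_apply, norm_smul, norm_inv, Real.norm_of_nonneg hs0]
        exact inv_mul_le_one_of_le₀ (hcs k) hs0
      · by_contra h
        rw [not_le] at h
        have htop : seqNorm (s⁻¹ • c) ≠ ⊤ := (h.trans ENNReal.one_lt_top).ne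
        have hr : (seqNorm (s⁻¹ • c)).toReal < 1 := by
          rwa [← ENNReal.toReal_one, ENNReal.toReal_lt_toReal htop ENNReal.one_ne_top]
        have h1 := (seqNorm_le_iff ENNReal.toReal_nonneg).1 (ENNReal.ofReal_toReal htop).ge
        have h2 : s ≤ s * (seqNorm (s⁻¹ • c)).toReal := ciSup_le fun k => by
          have := h1 k
          rw [Pi.smul_apply, norm_smul, norm_inv, Real.norm_of_nonneg hs0] at this
          rwa [inv_mul_le_iff₀ hpos] at this
        nlinarith
    have h1 : seqNorm (T (s⁻¹ • c)) ≤ ENNReal.ofReal q :=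
      (le_iSup₂ (f := fun c (_ : seqNorm c = 1) => seqNorm (T c)) (s⁻¹ • c) hnorm).trans hT
    have h2 := (seqNorm_le_iff hq).1 h1 j
    rw [map_smul, Pi.smul_apply, norm_smul, norm_inv, Real.norm_of_nonneg hs0,
      inv_mul_le_iff₀ hpos] at h2
    nlinarith

theorem IsContractive.exists_norm_iterate_le {B : ℤ →₀ Matrix (Fin 2) (Fin 2) ℝ}
    (hB : IsContractive (subdivOp B)) :
    ∃ C ρ : ℝ, 0 ≤ C ∧ 1 / 2 < ρ ∧ ρ < 1 ∧ ∀ c M, (∀ k, ‖c k‖ ≤ M) →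
      ∀ n k, ‖(subdivOp B)^[n] c k‖ ≤ C * ρ ^ n * M := by
  obtain ⟨N, hN, hlt⟩ := hB
  obtain ⟨K₀, hK₀, hK⟩ := exists_norm_subdivOp_le B
  set K := max K₀ 1
  have hK1 : 1 ≤ K := le_max_right _ _
  set q := (opNorm (subdivOp B)^[N]).toReal with hq
  have hq0 : 0 ≤ q := ENNReal.toReal_nonneg
  have htop : opNorm (subdivOp B)^[N] ≠ ⊤ := (hlt.trans ENNReal.one_lt_top).ne
  have hq1 : q < 1 := by
    rwa [hq, ← ENNReal.toReal_one, ENNReal.toReal_lt_toReal htop ENNReal.one_ne_top]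
  have hpow : ∀ n c, (subdivLin B ^ n) c = (subdivOp B)^[n] c := fun n c => by
    rw [Module.End.pow_apply]
    rfl
  have hstep : ∀ c M, (∀ k, ‖c k‖ ≤ M) → ∀ k, ‖(subdivOp B)^[N] c k‖ ≤ q * M := by
    intro c M hM k
    rw [← hpow]
    refine norm_le_of_opNorm_le hq0 ?_ hM k
    rw [hq, ENNReal.ofReal_toReal htop]
    exact (congrArg opNorm (funext (hpow N))).le
  -- Any ρ close enough to 1 works. The bound ρ > 1/2 lets ρ^n also dominate the dyadic decay in
  -- `IsDecaying.tendsto_initEval`.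
  obtain ⟨ρ, hρq, hρ, hρ1⟩ : ∃ ρ : ℝ, q < ρ ^ N ∧ 1 / 2 < ρ ∧ ρ < 1 := by
    have h : Filter.Tendsto (fun x : ℝ => x ^ N) (nhdsWithin 1 (Set.Iio 1)) (nhds 1) := by
      have := ((continuous_pow N).tendsto (1 : ℝ)).mono_left (nhdsWithin_le_nhds (s := Set.Iio 1))
      simpa using this
    have h2 : ∀ᶠ x : ℝ in nhdsWithin 1 (Set.Iio 1), 1 / 2 < x :=
      nhdsWithin_le_nhds (lt_mem_nhds (by norm_num))
    obtain ⟨ρ, h⟩ := ((h.eventually (lt_mem_nhds hq1)).and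
      (h2.and self_mem_nhdsWithin)).exists
    exact ⟨ρ, h⟩
  have hρ0 : 0 < ρ := by linarith
  have hiter : ∀ s c M, (∀ k, ‖c k‖ ≤ M) → ∀ k, ‖(subdivOp B)^[s] c k‖ ≤ K ^ s * M := by
    intro s
    induction s with
    | zero => simp
    | succ s ih =>
      intro c M hM k
      have hM0 : 0 ≤ M := (norm_nonneg _).trans (hM 0)
      rw [Function.iterate_succ_apply', pow_succ', mul_assoc]
      exact (hK _ _ (ih c M hM) k).trans
        (mul_le_mul_of_nonneg_right (le_max_left _ _) (by positivity))
  have hblock : ∀ t c M, (∀ k, ‖c k‖ ≤ M) → ∀ k, ‖(subdivOp B)^[N * t] c k‖ ≤ q ^ t * M := by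
    intro t
    induction t with
    | zero => simp
    | succ t ih =>
      intro c M hM k
      rw [Nat.mul_succ, Nat.add_comm, Function.iterate_add_apply, pow_succ', mul_assoc]
      exact hstep _ _ (ih c M hM) k
  -- K^N covers the fewer than N leftover steps, and ρ^{-N} the loss in N(n / N) ≥ n - N.
  refine ⟨K ^ N * (ρ ^ N)⁻¹, ρ, by positivity, hρ, hρ1, fun c M hM n k => ?_⟩
  have hM0 : 0 ≤ M := (norm_nonneg _).trans (hM 0)
  have hn : n = n % N + N * (n / N) := (Nat.mod_add_div n N).symm
  have hs : n % N ≤ N := (Nat.mod_lt _ hN).le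
  have h1 : ‖(subdivOp B)^[n] c k‖ ≤ K ^ (n % N) * (q ^ (n / N) * M) := by
    conv_lhs => rw [hn, Function.iterate_add_apply]
    exact hiter _ _ _ (hblock _ c M hM) k
  have h2 : q ^ (n / N) ≤ (ρ ^ N)⁻¹ * ρ ^ n := by
    have h3 : q ^ (n / N) ≤ ρ ^ (N * (n / N)) := by
      rw [pow_mul]
      exact pow_le_pow_left₀ hq0 hρq.le _
    refine h3.trans ?_
    rw [le_inv_mul_iff₀ (by positivity), ← pow_add]
    refine pow_le_pow_of_le_one hρ0.le hρ1.le ?_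
    omega
  calc _ ≤ K ^ (n % N) * (q ^ (n / N) * M) := h1
    _ ≤ K ^ N * ((ρ ^ N)⁻¹ * ρ ^ n * M) := by
      refine mul_le_mul (pow_le_pow_right₀ hK1 hs) (mul_le_mul_of_nonneg_right h2 hM0)
        (by positivity) (by positivity)
    _ = _ := by ring

end Contractivity

end HermiteSubdivision

namespace HermiteSubdivision

open Polynomial Filter Topology

/-! ### Limits of sequences on dyadic grids -/

section LocallyUniform

/-- Convergence of sequences on the grids `2^{-n} ℤ` to a function, uniformly on bounded sets. -/
def GridTendsto (y : ℕ → ℤ → ℝ) (ψ : ℝ → ℝ) : Prop :=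
  ∀ M : ℕ, ∀ ε > 0, ∀ᶠ n in atTop, ∀ j : ℤ, |(j : ℝ)| ≤ M * 2 ^ n →
    |y n j - ψ ((j : ℝ) / 2 ^ n)| ≤ ε

theorem GridTendsto.add {y z : ℕ → ℤ → ℝ} {ψ χ : ℝ → ℝ} (hy : GridTendsto y ψ)
    (hz : GridTendsto z χ) : GridTendsto (fun n j => y n j + z n j) (fun x => ψ x + χ x) := by
  intro M ε hε
  filter_upwards [hy M (ε / 2) (by positivity), hz M (ε / 2) (by positivity)] with n h1 h2 j hj
  have := abs_add_le (y n j - ψ ((j : ℝ) / 2 ^ n)) (z n j - χ ((j : ℝ) / 2 ^ n))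
  rw [show y n j + z n j - (ψ ((j : ℝ) / 2 ^ n) + χ ((j : ℝ) / 2 ^ n)) =
    (y n j - ψ ((j : ℝ) / 2 ^ n)) + (z n j - χ ((j : ℝ) / 2 ^ n)) by ring]
  linarith [h1 j hj, h2 j hj]

theorem gridTendsto_zero_of_abs_le {y : ℕ → ℤ → ℝ} {b : ℕ → ℝ} (hb : Tendsto b atTop (𝓝 0))
    (h : ∀ n j, |y n j| ≤ b n) : GridTendsto y (fun _ => 0) := by
  intro M ε hε
  filter_upwards [hb.eventually (gt_mem_nhds hε)] with n hn j _
  rw [sub_zero]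
  exact (h n j).trans hn.le

theorem gridTendsto_sum {ι : Type*} (s : Finset ι) {y : ι → ℕ → ℤ → ℝ} {ψ : ι → ℝ → ℝ}
    (h : ∀ i ∈ s, GridTendsto (y i) (ψ i)) :
    GridTendsto (fun n j => ∑ i ∈ s, y i n j) (fun x => ∑ i ∈ s, ψ i x) := by
  classical
  induction s using Finset.induction_on with
  | empty => exact gridTendsto_zero_of_abs_le tendsto_const_nhds (by simp)
  | insert i s hi ih =>
    simp_rw [Finset.sum_insert hi]
    exact (h i (Finset.mem_insert_self _ _)).add (ih fun k hk => h k (Finset.mem_insert_of_mem hk))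

theorem abs_div_two_pow_le {M : ℝ} {n : ℕ} {j : ℤ} (h : |(j : ℝ)| ≤ M * 2 ^ n) :
    |(j : ℝ) / 2 ^ n| ≤ M := by
  rw [abs_div, abs_of_pos (by positivity : (0 : ℝ) < 2 ^ n)]
  exact (div_le_iff₀ (by positivity)).2 h

theorem GridTendsto.mul_of_tendsto_zero {y : ℕ → ℤ → ℝ} {ψ : ℝ → ℝ} (hψ : Continuous ψ)
    (hy : GridTendsto y ψ) {b : ℕ → ℝ} (hb : Tendsto b atTop (𝓝 0)) :
    GridTendsto (fun n j => b n * y n j) (fun _ => 0) := by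
  intro M ε hε
  obtain ⟨S, hS⟩ := (isCompact_Icc (a := -(M : ℝ)) (b := M)).exists_bound_of_continuousOn
    hψ.continuousOn
  have hS1 : 0 < |S| + 1 := by positivity
  have hb' : ∀ᶠ n in atTop, |b n| < ε / (|S| + 1) := by
    have := hb.abs
    rw [abs_zero] at this
    exact this.eventually (gt_mem_nhds (by positivity))
  filter_upwards [hy M 1 one_pos, hb'] with n h1 h2 j hj
  have h3 := hS _ (abs_le.1 (abs_div_two_pow_le hj))
  rw [Real.norm_eq_abs] at h3
  have h4 : |y n j| ≤ |S| + 1 := by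
    have := abs_add_le (y n j - ψ ((j : ℝ) / 2 ^ n)) (ψ ((j : ℝ) / 2 ^ n))
    rw [sub_add_cancel] at this
    linarith [h1 j hj, le_abs_self S]
  rw [sub_zero, abs_mul]
  calc |b n| * |y n j| ≤ ε / (|S| + 1) * (|S| + 1) :=
        mul_le_mul h2.le h4 (abs_nonneg _) (by positivity)
    _ = ε := by field_simp

theorem GridTendsto.const_mul {y : ℕ → ℤ → ℝ} {ψ : ℝ → ℝ} (hy : GridTendsto y ψ) (a : ℝ) :
    GridTendsto (fun n j => a * y n j) (fun x => a * ψ x) := by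
  intro M ε hε
  have ha : 0 < |a| + 1 := by positivity
  filter_upwards [hy M (ε / (|a| + 1)) (by positivity)] with n h j hj
  rw [← mul_sub, abs_mul]
  calc |a| * |y n j - ψ ((j : ℝ) / 2 ^ n)| ≤ (|a| + 1) * (ε / (|a| + 1)) :=
        mul_le_mul (by linarith) (h j hj) (abs_nonneg _) ha.le
    _ = ε := by field_simp

theorem abs_sub_apply_zero_le {D : ℤ → ℝ} {η R : ℝ}
    (h : ∀ j : ℤ, |(j : ℝ)| ≤ R → |D (j + 1) - D j| ≤ η) (j : ℤ) (hj : |(j : ℝ)| ≤ R) :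
    |D j - D 0| ≤ |(j : ℝ)| * η := by
  induction j using Int.induction_on with
  | zero => simp
  | succ k ih =>
    push_cast at hj ⊢
    rw [abs_of_nonneg (by positivity : (0 : ℝ) ≤ (k : ℝ) + 1)] at hj ⊢
    have hk : |((k : ℤ) : ℝ)| ≤ R := by
      rw [Int.cast_natCast, Nat.abs_cast]
      linarith
    have h1 := ih hk
    have h2 := h k hk
    rw [Int.cast_natCast, Nat.abs_cast] at h1
    have := abs_add_le (D (k + 1) - D k) (D k - D 0)
    rw [sub_add_sub_cancel] at this
    linarith
  | pred k ih =>
    have hcast : ((-(k : ℤ) - 1 : ℤ) : ℝ) = -((k : ℝ) + 1) := by push_cast; ring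
    have hj' := hj
    rw [hcast, abs_neg, abs_of_nonneg (by positivity : (0 : ℝ) ≤ (k : ℝ) + 1)] at hj ⊢
    have hk : |((-(k : ℤ) : ℤ) : ℝ)| ≤ R := by
      rw [Int.cast_neg, abs_neg, Int.cast_natCast, Nat.abs_cast]
      linarith
    have h1 := ih hk
    have h2 := h (-(k : ℤ) - 1) hj'
    rw [Int.cast_neg, abs_neg, Int.cast_natCast, Nat.abs_cast] at h1
    rw [sub_add_cancel, abs_sub_comm] at h2
    have := abs_add_le (D (-(k : ℤ) - 1) - D (-(k : ℤ))) (D (-(k : ℤ)) - D 0)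
    rw [sub_add_sub_cancel] at this
    linarith

/-- If the divided differences of `y` converge to `ψ`, then `y` converges to an antiderivative. -/
theorem GridTendsto.integral {y w : ℕ → ℤ → ℝ} {ψ : ℝ → ℝ} {a : ℝ} (hψ : Continuous ψ)
    (hw : GridTendsto w ψ) (hyw : ∀ n j, y n (j + 1) - y n j = w n j / 2 ^ n)
    (h0 : Tendsto (fun n => y n 0) atTop (𝓝 a)) :
    GridTendsto y (fun x => a + ∫ t in (0 : ℝ)..x, ψ t) := by
  intro M ε hε
  -- At most M 2^n steps cost 2δ/2^n each, and the base point costs δ.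
  set δ := ε / (2 * M + 1) with hδ
  have hδ0 : 0 < δ := by positivity
  -- The interval is enlarged by 1 since a grid step from its edge may leave [-M, M].
  obtain ⟨η, hη, hunif⟩ := Metric.uniformContinuousOn_iff.1
    ((isCompact_Icc (a := -((M : ℝ) + 1)) (b := M + 1)).uniformContinuousOn_of_continuous
      hψ.continuousOn) δ hδ0
  have hpow : ∀ᶠ n : ℕ in atTop, (1 / 2 : ℝ) ^ n < η :=
    (tendsto_pow_atTop_nhds_zero_of_lt_one (by norm_num) (by norm_num)).eventually
      (gt_mem_nhds hη)
  have h0' : ∀ᶠ n : ℕ in atTop, |y n 0 - a| < δ := by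
    have := (h0.sub_const a).abs
    rw [sub_self, abs_zero] at this
    exact this.eventually (gt_mem_nhds hδ0)
  filter_upwards [hw M δ hδ0, hpow, h0'] with n h1 h2 h3 j hj
  have hp : (0 : ℝ) < 2 ^ n := by positivity
  have hp1 : (1 : ℝ) ≤ 2 ^ n := one_le_pow₀ (by norm_num)
  set D : ℤ → ℝ := fun j => y n j - (a + ∫ t in (0 : ℝ)..(j : ℝ) / 2 ^ n, ψ t) with hD
  have hstep : ∀ j : ℤ, |(j : ℝ)| ≤ M * 2 ^ n → |D (j + 1) - D j| ≤ 2 * δ / 2 ^ n := by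
    intro j hj
    have hx := abs_div_two_pow_le hj
    have hx1 := h1 j hj
    have hcast : (((j + 1 : ℤ) : ℝ)) / 2 ^ n = (j : ℝ) / 2 ^ n + 1 / 2 ^ n := by
      push_cast
      ring
    set x := (j : ℝ) / 2 ^ n
    have hi : ∀ u v : ℝ, IntervalIntegrable ψ MeasureTheory.volume u v := fun u v =>
      hψ.intervalIntegrable _ _
    have e1 : D (j + 1) - D j = w n j / 2 ^ n - ∫ t in x..(x + 1 / 2 ^ n), ψ t := by
      rw [← intervalIntegral.integral_interval_sub_left (hi 0 _) (hi 0 x), ← hyw, hD]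
      simp only [hcast]
      ring
    have e2 : D (j + 1) - D j = (w n j - ψ x) / 2 ^ n - ∫ t in x..(x + 1 / 2 ^ n), (ψ t - ψ x) := by
      rw [e1, intervalIntegral.integral_sub (hi _ _) (continuous_const.intervalIntegrable _ _),
        intervalIntegral.integral_const]
      simp only [add_sub_cancel_left, smul_eq_mul]
      ring
    have e3 : |∫ t in x..(x + 1 / 2 ^ n), (ψ t - ψ x)| ≤ δ / 2 ^ n := by
      have hle : ∀ t ∈ Set.uIoc x (x + 1 / 2 ^ n), ‖ψ t - ψ x‖ ≤ δ := by
        intro t ht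
        have hq : (0 : ℝ) < 1 / 2 ^ n := by positivity
        have hq1 : (1 : ℝ) / 2 ^ n ≤ 1 := (div_le_one hp).2 hp1
        rw [Set.uIoc_of_le (by linarith)] at ht
        obtain ⟨hx2, hx3⟩ := abs_le.1 hx
        rw [← dist_eq_norm]
        refine (hunif t ⟨by linarith [ht.1], by linarith [ht.2]⟩ x
          ⟨by linarith, by linarith⟩ ?_).le
        rw [Real.dist_eq, abs_of_nonneg (by linarith [ht.1])]
        rw [one_div_pow] at h2
        linarith [ht.2]
      have := intervalIntegral.norm_integral_le_of_norm_le_const hle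
      rw [add_sub_cancel_left, abs_of_pos (by positivity), Real.norm_eq_abs, mul_one_div] at this
      exact this
    have e4 : |(w n j - ψ x) / 2 ^ n| ≤ δ / 2 ^ n := by
      rw [abs_div, abs_of_pos hp]
      exact div_le_div_of_nonneg_right hx1 hp.le
    rw [e2]
    have := abs_sub ((w n j - ψ x) / 2 ^ n) (∫ t in x..(x + 1 / 2 ^ n), (ψ t - ψ x))
    have e5 : 2 * δ / 2 ^ n = δ / 2 ^ n + δ / 2 ^ n := by ring
    linarith
  have h4 := abs_sub_apply_zero_le hstep j hj
  have h5 : D 0 = y n 0 - a := by simp [hD]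
  have h6 : |(j : ℝ)| * (2 * δ / 2 ^ n) ≤ 2 * M * δ := by
    calc |(j : ℝ)| * (2 * δ / 2 ^ n) ≤ (M * 2 ^ n) * (2 * δ / 2 ^ n) :=
          mul_le_mul_of_nonneg_right hj (by positivity)
      _ = 2 * M * δ := by field_simp
  have h7 : (2 * M + 1) * δ = ε := by rw [hδ]; field_simp
  have h8 := abs_add_le (D j - D 0) (D 0)
  rw [sub_add_cancel, h5] at h8
  rw [h5] at h4
  change |D j| ≤ ε
  linarith

/-- Dyadic cells around x are nested, so the refinement estimate applies along the floors of 2^n x.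
-/
theorem floor_two_pow_succ_mul_div (n : ℕ) (x : ℝ) :
    ⌊2 ^ (n + 1) * x⌋ / 2 = ⌊2 ^ n * x⌋ := by
  symm
  rw [Int.floor_eq_iff]
  have h1 := Int.floor_le (2 ^ (n + 1) * x)
  have h2 := Int.lt_floor_add_one (2 ^ (n + 1) * x)
  set k := ⌊2 ^ (n + 1) * x⌋
  have h3 : ((2 * (k / 2) : ℤ) : ℝ) ≤ k := Int.cast_le.2 (by omega)
  have h4 : (k : ℝ) ≤ ((2 * (k / 2) + 1 : ℤ) : ℝ) := Int.cast_le.2 (by omega)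
  push_cast at h3 h4
  rw [pow_succ'] at h1 h2
  constructor <;> linarith

/-- Geometric decay of the differences and of the refinement error yields a continuous limit. -/
theorem exists_continuous_gridTendsto {w : ℕ → ℤ → ℝ} {C ρ : ℝ} (hρ0 : 0 ≤ ρ) (hρ1 : ρ < 1)
    (hrefine : ∀ n j, |w (n + 1) j - w n (j / 2)| ≤ C * ρ ^ n)
    (hdiff : ∀ n j, |w n (j + 1) - w n j| ≤ C * ρ ^ n) :
    ∃ ψ : ℝ → ℝ, Continuous ψ ∧ GridTendsto w ψ := by
  have hC : 0 ≤ C := by simpa using (abs_nonneg _).trans (hdiff 0 0)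
  have hgeo : ∀ x : ℝ, ∀ n, dist (w n ⌊2 ^ n * x⌋) (w (n + 1) ⌊2 ^ (n + 1) * x⌋) ≤ C * ρ ^ n := by
    intro x n
    rw [dist_comm, Real.dist_eq, ← floor_two_pow_succ_mul_div n x]
    exact hrefine n _
  choose ψ hψ using fun x => cauchySeq_tendsto_of_complete
    (cauchySeq_of_le_geometric ρ C hρ1 (hgeo x))
  have hbound : ∀ x n, |w n ⌊2 ^ n * x⌋ - ψ x| ≤ C / (1 - ρ) * ρ ^ n := fun x n => by
    have := dist_le_of_le_geometric_of_tendsto ρ C hρ1 (hgeo x) (hψ x) n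
    rw [Real.dist_eq] at this
    rwa [div_mul_eq_mul_div]
  have hlim : ∀ K : ℝ, Tendsto (fun n => K * ρ ^ n) atTop (𝓝 0) := fun K => by
    simpa using (tendsto_pow_atTop_nhds_zero_of_lt_one hρ0 hρ1).const_mul K
  refine ⟨ψ, Metric.continuous_iff.2 fun x ε hε => ?_, fun M ε hε => ?_⟩
  · obtain ⟨n, hn⟩ := ((hlim (C / (1 - ρ) + C + C / (1 - ρ))).eventually (gt_mem_nhds hε)).exists
    have hp : (0 : ℝ) < 2 ^ n := by positivity
    refine ⟨1 / 2 ^ n, by positivity, fun z hz => ?_⟩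
    have hfl : |w n ⌊2 ^ n * z⌋ - w n ⌊2 ^ n * x⌋| ≤ C * ρ ^ n := by
      rw [Real.dist_eq, abs_lt, lt_div_iff₀ hp, neg_lt, ← neg_sub, neg_neg, lt_div_iff₀ hp] at hz
      have h1 := Int.floor_le (2 ^ n * z)
      have h2 := Int.lt_floor_add_one (2 ^ n * z)
      have h3 := Int.floor_le (2 ^ n * x)
      have h4 := Int.lt_floor_add_one (2 ^ n * x)
      have h5 : ⌊2 ^ n * z⌋ < ⌊2 ^ n * x⌋ + 2 := by
        have : ((⌊2 ^ n * z⌋ : ℤ) : ℝ) < ((⌊2 ^ n * x⌋ + 2 : ℤ) : ℝ) := by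
          push_cast
          nlinarith [hz.1, hz.2]
        exact_mod_cast this
      have h6 : ⌊2 ^ n * x⌋ < ⌊2 ^ n * z⌋ + 2 := by
        have : ((⌊2 ^ n * x⌋ : ℤ) : ℝ) < ((⌊2 ^ n * z⌋ + 2 : ℤ) : ℝ) := by
          push_cast
          nlinarith [hz.1, hz.2]
        exact_mod_cast this
      have h7 : ⌊2 ^ n * z⌋ = ⌊2 ^ n * x⌋ ∨ ⌊2 ^ n * z⌋ = ⌊2 ^ n * x⌋ + 1 ∨
          ⌊2 ^ n * x⌋ = ⌊2 ^ n * z⌋ + 1 := by omega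
      rcases h7 with h | h | h
      · rw [h, sub_self, abs_zero]
        positivity
      · rw [h]
        exact hdiff _ _
      · rw [h, abs_sub_comm]
        exact hdiff _ _
    have e1 := hbound x n
    have e2 := hbound z n
    rw [Real.dist_eq]
    rw [abs_le] at hfl e1 e2
    refine lt_of_le_of_lt (abs_le.2 ⟨?_, ?_⟩) hn <;> linarith [hfl.1, hfl.2, e1.1, e1.2, e2.1, e2.2]
  · filter_upwards [(hlim (C / (1 - ρ))).eventually (gt_mem_nhds hε)] with n hn j _
    have := hbound ((j : ℝ) / 2 ^ n) n
    rw [mul_div_cancel₀ _ (by positivity), Int.floor_intCast] at this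
    exact this.trans hn.le

theorem contDiff_succ_add_integral {ψ : ℝ → ℝ} {i : ℕ} (h : ContDiff ℝ i ψ) (a : ℝ) :
    ContDiff ℝ (i + 1 : ℕ) (fun x => a + ∫ t in (0 : ℝ)..x, ψ t) ∧
      deriv (fun x => a + ∫ t in (0 : ℝ)..x, ψ t) = ψ := by
  have hd : ∀ x, HasDerivAt (fun x => a + ∫ t in (0 : ℝ)..x, ψ t) (ψ x) x := fun x =>
    (intervalIntegral.integral_hasDerivAt_right (h.continuous.intervalIntegrable _ _)
      (h.continuous.stronglyMeasurableAtFilter _ _) h.continuous.continuousAt).const_add a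
  have hd' : deriv (fun x => a + ∫ t in (0 : ℝ)..x, ψ t) = ψ := funext fun x => (hd x).deriv
  refine ⟨?_, hd'⟩
  push_cast
  rw [contDiff_succ_iff_deriv]
  exact ⟨fun x => (hd x).differentiableAt, by simp, by rwa [hd']⟩

end LocallyUniform

end HermiteSubdivision

namespace HermiteSubdivision

open Polynomial Filter Topology

/-! ### Smooth limits of the Hermite scheme -/

section Convergence

/-- Sequences `E n = S_A^n c` whose images under the Gregory operator decay like `(ρ / 2^d)^n`. -/
structure IsDecaying (A : ℤ →₀ Matrix (Fin 2) (Fin 2) ℝ) (d : ℕ) (E : ℕ → ℤ → Fin 2 → ℝ)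
    (C ρ : ℝ) : Prop where
  succ : ∀ n, E (n + 1) = subdivOp A (E n)
  bound : ∀ n k, ‖gregoryOp d (E n) k‖ ≤ C * (ρ / 2 ^ d) ^ n
  nonneg : 0 ≤ C
  half_le : 1 / 2 ≤ ρ
  lt_one : ρ < 1

theorem IsContractive.isDecaying {A B : ℤ →₀ Matrix (Fin 2) (Fin 2) ℝ} {d : ℕ}
    (hB : IsContractive (subdivOp B))
    (hAB : ∀ c, gregoryOp d (subdivOp A c) = ((1 / 2 : ℝ) ^ d) • subdivOp B (gregoryOp d c))
    {c : ℤ → Fin 2 → ℝ} (hc : seqNorm c < ⊤) :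
    ∃ C ρ, IsDecaying A d (fun n => (subdivOp A)^[n] c) C ρ := by
  obtain ⟨C, ρ, hC, hρ, hρ1, hbound⟩ := hB.exists_norm_iterate_le
  have hcM := (seqNorm_le_iff ENNReal.toReal_nonneg).1 (ENNReal.ofReal_toReal hc.ne).ge
  have hG : ∃ K : ℝ, 0 ≤ K ∧ ∀ k, ‖gregoryOp d c k‖ ≤ K := by
    choose K hK h using fun a => exists_bound_of_mem_localDual (coordEval_comp_gregoryLin_mem d 0 a)
    set M := (seqNorm c).toReal
    have hM : 0 ≤ M := ENNReal.toReal_nonneg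
    refine ⟨max (K 0) (K 1) * M, mul_nonneg ((hK 0).trans (le_max_left _ _)) hM, fun k => ?_⟩
    refine (pi_norm_le_iff_of_nonneg (mul_nonneg ((hK 0).trans (le_max_left _ _)) hM)).2
      fun a => ?_
    have h1 := h a (fun i => c (i + k)) M fun i => hcM _
    simp only [LinearMap.comp_apply, gregoryLin_apply, gregoryOp_shift, coordEval_apply,
      zero_add] at h1
    refine h1.trans (mul_le_mul_of_nonneg_right ?_ hM)
    fin_cases a
    · exact le_max_left _ _
    · exact le_max_right _ _
  obtain ⟨K, hK, hGK⟩ := hG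
  refine ⟨C * K, ρ, fun n => Function.iterate_succ_apply' _ _ _, fun n k => ?_, by positivity,
    hρ.le, hρ1⟩
  have hiter : ∀ n, gregoryOp d ((subdivOp A)^[n] c) =
      ((1 / 2 : ℝ) ^ d) ^ n • (subdivOp B)^[n] (gregoryOp d c) := by
    intro n
    induction n with
    | zero => simp
    | succ n ih =>
      rw [Function.iterate_succ_apply', hAB, ih, ← subdivLin_apply, map_smul, smul_smul,
        Function.iterate_succ_apply', subdivLin_apply, ← pow_succ']
  rw [hiter, Pi.smul_apply, norm_smul, Real.norm_of_nonneg (by positivity)]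
  calc ((1 / 2 : ℝ) ^ d) ^ n * ‖(subdivOp B)^[n] (gregoryOp d c) k‖
      ≤ ((1 / 2 : ℝ) ^ d) ^ n * (C * ρ ^ n * K) :=
        mul_le_mul_of_nonneg_left (hbound _ K hGK n k) (by positivity)
    _ = C * K * (ρ / 2 ^ d) ^ n := by
        rw [div_pow ρ, one_div_pow, one_div_pow]
        ring

variable {A : ℤ →₀ Matrix (Fin 2) (Fin 2) ℝ} {d : ℕ} {E : ℕ → ℤ → Fin 2 → ℝ} {C ρ : ℝ}

/-- Descending induction on m. The one-step error of `initEval m` kills polynomials of degree at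
most m, so it involves only higher initial data, already known to be O(2^{-kn}) with k > m, and the
Gregory image. -/
theorem IsDecaying.tendsto_initEval (hE : IsDecaying A d E C ρ) (hd : 1 ≤ d)
    (hA : HasSpectralOrder A d) (m : ℕ) (hm : m ≤ d) :
    ∃ a, Tendsto (fun n => ((2 : ℝ) ^ m) ^ n * initEval m (E n)) atTop (𝓝 a) := by
  obtain ⟨N, hN⟩ := exists_dual_polynomials
  have hρ0 : 0 < ρ := by linarith [hE.half_le]
  induction hi : d - m using Nat.strong_induction_on generalizing m with
  | _ i ih =>
  set f := initEval m ∘ₗ subdivLin A - ((1 / 2 : ℝ) ^ m) • initEval m with hf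
  have hfN : ∀ k ≤ m, f (polySample (N k)) = 0 := by
    intro k hk
    obtain ⟨q, hq, hq1, hq2⟩ := hA.exists_polySample hm (N k) ((hN k).1.trans hk)
    rw [hf, LinearMap.sub_apply, LinearMap.comp_apply, subdivLin_apply, hq2, LinearMap.smul_apply,
      initEval_polySample hq, initEval_polySample ((hN k).1.trans hk), hq1, smul_eq_mul]
    ring
  obtain ⟨g, hg, hfg⟩ := exists_eq_sum_add_gregoryOp hd hN (f := f) (sub_mem
    (comp_mem_localDual (coordEval_comp_subdivLin_mem A) (initEval_mem m))
    (Submodule.smul_mem _ _ (initEval_mem m)))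
  obtain ⟨K, hK, hgK⟩ := exists_bound_of_mem_localDual hg
  have hterm : ∀ k ∈ Finset.range (d + 1), ∃ Y : ℝ, ∀ n,
      |f (polySample (N k)) * initEval k (E n)| ≤ Y * (ρ / 2 ^ m) ^ n := by
    intro k hk
    have hk : k ≤ d := Nat.lt_succ_iff.1 (Finset.mem_range.1 hk)
    rcases le_or_gt k m with h | h
    · exact ⟨0, fun n => by simp [hfN k h]⟩
    · obtain ⟨a, ha⟩ := ih (d - k) (by omega) k hk rfl
      obtain ⟨Y, hY⟩ := ha.abs.bddAbove_range
      have hY : ∀ n, |((2 : ℝ) ^ k) ^ n * initEval k (E n)| ≤ Y := fun n => hY ⟨n, rfl⟩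
      refine ⟨|f (polySample (N k))| * Y, fun n => ?_⟩
      rw [abs_mul, mul_assoc]
      refine mul_le_mul_of_nonneg_left ?_ (abs_nonneg _)
      have h1 := hY n
      have hY0 : 0 ≤ Y := (abs_nonneg _).trans h1
      rw [abs_mul, abs_of_pos (by positivity), mul_comm, ← le_div_iff₀ (by positivity)] at h1
      refine h1.trans ?_
      rw [div_eq_mul_inv, ← inv_pow]
      refine mul_le_mul_of_nonneg_left (pow_le_pow_left₀ (by positivity) ?_ n) hY0
      rw [le_div_iff₀ (by positivity), ← div_eq_inv_mul, div_le_iff₀ (by positivity)]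
      -- As k ≥ m + 1 and ρ ≥ 1/2, the rate 2^{-k} is at most ρ/2^m.
      calc (2 : ℝ) ^ m = 1 / 2 * 2 ^ (m + 1) := by rw [pow_succ]; ring
        _ ≤ ρ * 2 ^ k := mul_le_mul hE.half_le (pow_le_pow_right₀ (by norm_num) h)
          (by positivity) hρ0.le
  choose! Y hY using hterm
  have hstep : ∀ n, |f (E n)| ≤ (∑ k ∈ Finset.range (d + 1), Y k + K * C) * (ρ / 2 ^ m) ^ n := by
    intro n
    rw [hfg, add_mul, Finset.sum_mul]
    refine (abs_add_le _ _).trans (add_le_add ((Finset.abs_sum_le_sum_abs _ _).trans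
      (Finset.sum_le_sum fun k hk => hY k hk n)) ?_)
    refine (hgK _ _ (hE.bound n)).trans ?_
    rw [← mul_assoc]
    refine mul_le_mul_of_nonneg_left (pow_le_pow_left₀ (by positivity) ?_ n)
      (mul_nonneg hK hE.nonneg)
    exact div_le_div_of_nonneg_left hρ0.le (by positivity) (pow_le_pow_right₀ (by norm_num) hm)
  refine cauchySeq_tendsto_of_complete (cauchySeq_of_le_geometric ρ
    (2 ^ m * (∑ k ∈ Finset.range (d + 1), Y k + K * C)) hE.lt_one fun n => ?_)
  have h1 : ((2 : ℝ) ^ m) ^ (n + 1) * initEval m (E (n + 1)) - (2 ^ m) ^ n * initEval m (E n) =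
      (2 ^ m) ^ (n + 1) * f (E n) := by
    rw [hf, LinearMap.sub_apply, LinearMap.comp_apply, subdivLin_apply, LinearMap.smul_apply,
      ← hE.succ, smul_eq_mul, mul_sub, ← mul_assoc, pow_succ, mul_assoc _ _ ((1 / 2 : ℝ) ^ m),
      ← mul_pow 2 (1 / 2 : ℝ) m]
    norm_num
  rw [dist_comm, Real.dist_eq, h1, abs_mul, abs_of_pos (by positivity)]
  calc ((2 : ℝ) ^ m) ^ (n + 1) * |f (E n)|
      ≤ (2 ^ m) ^ (n + 1) * ((∑ k ∈ Finset.range (d + 1), Y k + K * C) * (ρ / 2 ^ m) ^ n) :=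
        mul_le_mul_of_nonneg_left (hstep n) (by positivity)
    _ = _ := by
        rw [div_pow, pow_succ]
        field_simp

/-- The scaled `l`-th differences of the derivative components. -/
noncomputable def scaledDiff (E : ℕ → ℤ → Fin 2 → ℝ) (l n : ℕ) (j : ℤ) : ℝ :=
  ((2 : ℝ) ^ (l + 1)) ^ n * diffEval l j 1 (E n)

theorem scaledDiff_add_one_sub (E : ℕ → ℤ → Fin 2 → ℝ) (l n : ℕ) (j : ℤ) :
    scaledDiff E l n (j + 1) - scaledDiff E l n j = scaledDiff E (l + 1) n j / 2 ^ n := by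
  simp only [scaledDiff]
  rw [diffEval_succ, LinearMap.sub_apply, pow_succ _ (l + 1), mul_pow]
  field_simp

/-- For p of degree at most e + 1, Δ^e p' is a constant multiple of the top coefficient, which S_A
scales by 2^{-(e+1)}. So the refinement error at every j, even or odd, factors through the Gregory
image; the increments are its first row. -/
theorem IsDecaying.exists_continuous_gridTendsto_scaledDiff {e : ℕ}
    (hE : IsDecaying A (e + 1) E C ρ) (hA : HasSpectralOrder A (e + 1)) :
    ∃ ψ : ℝ → ℝ, Continuous ψ ∧ GridTendsto (scaledDiff E e) ψ := by
  obtain ⟨N, hN⟩ := exists_dual_polynomials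
  have hρ0 : 0 < ρ := by linarith [hE.half_le]
  have hC := hE.nonneg
  set f : ℤ → Module.Dual ℝ (ℤ → Fin 2 → ℝ) := fun j =>
    diffEval e j 1 ∘ₗ subdivLin A - ((1 / 2 : ℝ) ^ (e + 1)) • diffEval e (j / 2) 1 with hf
  have hfapp : ∀ j c, f j c =
      diffEval e j 1 (subdivOp A c) - (1 / 2 : ℝ) ^ (e + 1) * diffEval e (j / 2) 1 c :=
    fun j c => rfl
  obtain ⟨K, hK, hfK⟩ := exists_uniform_bound (f := f) (T := gregoryOp (e + 1))
    (fun c j m => by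
      rw [hfapp, hfapp, diffEval_shift,
        show (subdivOp A fun i => c (i + m)) = fun i => subdivOp A c (i + 2 * m) from
          funext fun i => subdivOp_shift A c i m, diffEval_shift,
        show (j + 2 * m) / 2 = j / 2 + m by omega])
    (fun c m => gregoryOp_shift _ c m)
    (fun j => by
      obtain ⟨g, hg, hfg⟩ := exists_eq_sum_add_gregoryOp (Nat.le_add_left 1 e) hN (f := f j)
        (sub_mem (comp_mem_localDual (coordEval_comp_subdivLin_mem A) (diffEval_mem e j 1))
          (Submodule.smul_mem _ _ (diffEval_mem e _ 1)))
      refine ⟨g, hg, fun c => ?_⟩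
      rw [hfg, Finset.sum_eq_zero, zero_add]
      intro k hk
      have hk : (N k).natDegree ≤ e + 1 :=
        (hN k).1.trans (Nat.lt_succ_iff.1 (Finset.mem_range.1 hk))
      obtain ⟨q, hq, hq1, hq2⟩ := hA.exists_polySample le_rfl (N k) hk
      rw [hfapp, hq2, diffEval_polySample hq, diffEval_polySample hk, hq1]
      ring)
  refine exists_continuous_gridTendsto (C := max (2 ^ (e + 1) * (K * C)) C) hρ0.le hE.lt_one
    (fun n j => ?_) fun n j => ?_
  · have h1 : scaledDiff E e (n + 1) j - scaledDiff E e n (j / 2) =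
        (2 ^ (e + 1)) ^ (n + 1) * f j (E n) := by
      rw [hfapp, scaledDiff, scaledDiff, ← hE.succ, mul_sub, ← mul_assoc,
        pow_succ ((2 : ℝ) ^ (e + 1)) n, mul_assoc _ _ ((1 / 2 : ℝ) ^ (e + 1)),
        ← mul_pow 2 (1 / 2 : ℝ)]
      norm_num
    rw [h1, abs_mul, abs_of_pos (by positivity)]
    calc ((2 : ℝ) ^ (e + 1)) ^ (n + 1) * |f j (E n)|
        ≤ (2 ^ (e + 1)) ^ (n + 1) * (K * (C * (ρ / 2 ^ (e + 1)) ^ n)) :=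
          mul_le_mul_of_nonneg_left (hfK _ _ (hE.bound n) j) (by positivity)
      _ = 2 ^ (e + 1) * (K * C) * ρ ^ n := by
          rw [div_pow, pow_succ ((2 : ℝ) ^ (e + 1)) n]
          field_simp
      _ ≤ _ := mul_le_mul_of_nonneg_right (le_max_left _ _) (by positivity)
  · have h1 : scaledDiff E e n (j + 1) - scaledDiff E e n j =
        (2 ^ (e + 1)) ^ n * gregoryOp (e + 1) (E n) j 0 := by
      rw [gregoryOp_apply_zero, diffEval_succ, scaledDiff, scaledDiff, LinearMap.sub_apply, mul_sub]
    rw [h1, abs_mul, abs_of_pos (by positivity)]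
    calc ((2 : ℝ) ^ (e + 1)) ^ n * |gregoryOp (e + 1) (E n) j 0|
        ≤ (2 ^ (e + 1)) ^ n * (C * (ρ / 2 ^ (e + 1)) ^ n) :=
          mul_le_mul_of_nonneg_left ((norm_le_pi_norm (gregoryOp (e + 1) (E n) j) 0).trans
            (hE.bound n j)) (by positivity)
      _ = C * ρ ^ n := by
          rw [div_pow]
          field_simp
      _ ≤ _ := mul_le_mul_of_nonneg_right (le_max_right _ _) (by positivity)

/-- Each integration lowers the difference order and gains one derivative; the integration constant
is the limit of the scaled initial datum. -/
theorem IsDecaying.exists_contDiff_gridTendsto_scaledDiff {e : ℕ}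
    (hE : IsDecaying A (e + 1) E C ρ) (hA : HasSpectralOrder A (e + 1)) (i : ℕ) (hi : i ≤ e) :
    ∃ ψ : ℝ → ℝ, ContDiff ℝ i ψ ∧ GridTendsto (scaledDiff E (e - i)) ψ := by
  induction i with
  | zero =>
    obtain ⟨ψ, h1, h2⟩ := hE.exists_continuous_gridTendsto_scaledDiff hA
    exact ⟨ψ, by simpa using h1, h2⟩
  | succ i ih =>
    obtain ⟨ψ, h1, h2⟩ := ih (by omega)
    obtain ⟨a, ha⟩ := hE.tendsto_initEval (Nat.le_add_left 1 e) hA (e - (i + 1) + 1) (by omega)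
    refine ⟨_, (contDiff_succ_add_integral h1 a).1, h2.integral h1.continuous (fun n j => ?_) ha⟩
    rw [scaledDiff_add_one_sub, show e - (i + 1) + 1 = e - i by omega]

theorem IsDecaying.exists_contDiff_limit {e : ℕ}
    (hE : IsDecaying A (e + 1) E C ρ) (hA : HasSpectralOrder A (e + 1)) :
    ∃ φ : ℝ → ℝ, ContDiff ℝ (e + 1 : ℕ) φ ∧ GridTendsto (fun n j => E n j 0) φ ∧
      GridTendsto (fun n j => 2 ^ n * E n j 1) (deriv φ) := by
  have hρ0 : 0 < ρ := by linarith [hE.half_le]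
  have hC := hE.nonneg
  obtain ⟨ψ, hψ, hψw⟩ := hE.exists_contDiff_gridTendsto_scaledDiff hA e le_rfl
  rw [Nat.sub_self] at hψw
  obtain ⟨a, ha⟩ := hE.tendsto_initEval (Nat.le_add_left 1 e) hA 0 (Nat.zero_le _)
  obtain ⟨h1, h2⟩ := contDiff_succ_add_integral hψ a
  -- The Gregory corrections of order l + 1 ≥ 1 carry an extra factor 2^{-(l+1)n} on convergent
  -- sequences, so only the term with G_0 = 1 survives.
  have hlow : GridTendsto (fun n j => ∑ l ∈ Finset.range e, gregoryCoeff (l + 1) *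
      (((1 / 2 : ℝ) ^ (l + 1)) ^ n * scaledDiff E (l + 1) n j)) (fun _ => 0) := by
    have := gridTendsto_sum (Finset.range e) (ψ := fun l _ => gregoryCoeff (l + 1) * 0)
      (y := fun l n j => gregoryCoeff (l + 1) *
        (((1 / 2 : ℝ) ^ (l + 1)) ^ n * scaledDiff E (l + 1) n j)) fun l hl => ?_
    · simpa using this
    · have hl : l < e := Finset.mem_range.1 hl
      obtain ⟨χ, hχ, hχw⟩ :=
        hE.exists_contDiff_gridTendsto_scaledDiff hA (e - (l + 1)) (by omega)
      rw [show e - (e - (l + 1)) = l + 1 by omega] at hχw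
      exact (hχw.mul_of_tendsto_zero hχ.continuous (tendsto_pow_atTop_nhds_zero_of_lt_one
        (by positivity) (pow_lt_one₀ (by norm_num) (by norm_num) (by omega)))).const_mul _
  have herr : GridTendsto (fun n j => 2 ^ n * gregoryOp (e + 1) (E n) j 1) (fun _ => 0) := by
    have hlim : Tendsto (fun n => C * ρ ^ n) atTop (𝓝 0) := by
      simpa using (tendsto_pow_atTop_nhds_zero_of_lt_one hρ0.le hE.lt_one).const_mul C
    refine gridTendsto_zero_of_abs_le hlim fun n j => ?_
    rw [abs_mul, abs_of_pos (by positivity)]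
    calc (2 : ℝ) ^ n * |gregoryOp (e + 1) (E n) j 1| ≤ 2 ^ n * (C * (ρ / 2 ^ (e + 1)) ^ n) :=
          mul_le_mul_of_nonneg_left ((norm_le_pi_norm (gregoryOp (e + 1) (E n) j) 1).trans
            (hE.bound n j)) (by positivity)
      _ ≤ 2 ^ n * (C * (ρ / 2) ^ n) := by
          have : (2 : ℝ) ≤ 2 ^ (e + 1) := le_self_pow₀ (by norm_num) (by omega)
          gcongr
      _ = C * ρ ^ n := by
          rw [div_pow]
          field_simp
  have hG0 : gregoryCoeff 0 = 1 := by simp [gregoryCoeff, Nat.stirlingFirst_zero]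
  have hw : GridTendsto (fun n j => scaledDiff E 0 n j + (2 ^ n * gregoryOp (e + 1) (E n) j 1 +
      ∑ l ∈ Finset.range e, gregoryCoeff (l + 1) *
        (((1 / 2 : ℝ) ^ (l + 1)) ^ n * scaledDiff E (l + 1) n j))) ψ := by
    simpa using hψw.add (herr.add hlow)
  refine ⟨_, h1, hw.integral hψ.continuous (fun n j => ?_) (by simpa [initEval] using ha), ?_⟩
  · have hp : (2 : ℝ) ^ n ≠ 0 := by positivity
    have h3 : ∀ l, ((1 / 2 : ℝ) ^ l) ^ n * scaledDiff E l n j = 2 ^ n * diffEval l j 1 (E n) := by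
      intro l
      rw [scaledDiff, ← mul_assoc, ← mul_pow, pow_succ, ← mul_assoc, ← mul_pow]
      norm_num
    rw [eq_div_iff hp, gregoryOp_apply_one, Finset.sum_range_succ', hG0]
    have h4 := h3 0
    rw [pow_zero, one_pow, one_mul] at h4
    simp_rw [h3, h4]
    simp only [diffEval_succ, LinearMap.sub_apply, diffEval_zero, coordEval_apply]
    rw [mul_sub, mul_add, Finset.mul_sum]
    simp_rw [mul_left_comm ((2 : ℝ) ^ n)]
    ring
  · rw [h2]
    have : (fun n j => 2 ^ n * E n j 1) = scaledDiff E 0 := by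
      funext n j
      simp [scaledDiff, diffEval_zero]
    rwa [this]

/-- The recursion telescopes to D^n c^{[n]} = S_A^n c^{[0]}; undoing D^n scales the derivative
component by 2^n. -/
theorem IsHermiteSeq.apply_eq {c : ℕ → ℤ → Fin 2 → ℝ} (hc : IsHermiteSeq A c) (n : ℕ) (j : ℤ) :
    c n j = ![(subdivOp A)^[n] (c 0) j 0, 2 ^ n * (subdivOp A)^[n] (c 0) j 1] := by
  have h : ∀ n, (fun j => (hermiteD ^ n).mulVec (c n j)) = (subdivOp A)^[n] (c 0) := by
    intro n
    induction n with
    | zero => simp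
    | succ n ih => rw [Function.iterate_succ_apply', ← ih, hc n]
  rw [← h n]
  simp only [hermiteD, Matrix.diagonal_pow, Matrix.mulVec_diagonal]
  funext a
  fin_cases a
  · simp
  · simp

theorem hermiteTendsto_of_gridTendsto {c : ℕ → ℤ → Fin 2 → ℝ} {φ : ℝ → ℝ}
    (h0 : GridTendsto (fun n j => c n j 0) φ) (h1 : GridTendsto (fun n j => c n j 1) (deriv φ)) :
    HermiteTendsto c φ := by
  intro K hK
  obtain ⟨R, hR⟩ := hK.isBounded.exists_norm_le
  obtain ⟨M, hM⟩ := exists_nat_ge R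
  rw [ENNReal.tendsto_nhds_zero]
  intro ε hε
  obtain ⟨δ, hδ, hδε⟩ : ∃ δ : ℝ, 0 < δ ∧ ENNReal.ofReal δ ≤ ε := by
    rcases eq_or_ne ε ⊤ with rfl | h
    · exact ⟨1, one_pos, le_top⟩
    · exact ⟨ε.toReal, ENNReal.toReal_pos hε.ne' h, ENNReal.ofReal_toReal_le⟩
  filter_upwards [h0 M δ hδ, h1 M δ hδ] with n e0 e1
  refine iSup₂_le fun j hj => ?_
  refine le_trans ?_ hδε
  have hj' : |(j : ℝ)| ≤ M * 2 ^ n := by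
    have := (hR _ hj).trans hM
    rwa [Real.norm_eq_abs, abs_div, abs_of_pos (by positivity : (0 : ℝ) < 2 ^ n),
      div_le_iff₀ (by positivity)] at this
  rw [← ofReal_norm]
  refine ENNReal.ofReal_le_ofReal ((pi_norm_le_iff_of_nonneg hδ.le).2 fun a => ?_)
  fin_cases a
  · exact e0 j hj'
  · exact e1 j hj'

/-- The spectral condition for k = 0 forces `P 0 = 1`, so constants are reproduced; this supplies
the nonzero limit. -/
theorem isHermiteSeq_const (hd : HasSpectralOrder A d) :
    IsHermiteSeq A (fun _ _ => ![1, 0]) := by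
  have h1 : subdivOp A (polySample 1) = polySample 1 := by
    obtain ⟨P, hP⟩ := hd
    obtain ⟨h1, h2, h3⟩ := hP 0 (Nat.zero_le _)
    have hP0 : P 0 = 1 := by
      rw [eq_C_of_natDegree_le_zero h1, h2]
      simp
    rwa [hP0, pow_zero, one_smul] at h3
  have h2 : polySample 1 = fun _ => ![1, 0] := by
    funext j
    simp [polySample]
  have h3 : ∀ n : ℕ, (hermiteD ^ n).mulVec ![1, 0] = ![1, 0] := by
    intro n
    simp only [hermiteD, Matrix.diagonal_pow]
    funext a
    rw [Matrix.mulVec_diagonal]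
    fin_cases a <;> simp
  intro n
  simp only [h3]
  rw [← h2, h1]

theorem hermiteTendsto_const : HermiteTendsto (fun _ _ => ![1, 0]) (fun _ => 1) := by
  refine hermiteTendsto_of_gridTendsto (fun M ε hε => ?_) fun M ε hε => ?_ <;>
  exact Eventually.of_forall fun n j _ => by simpa using hε.le

theorem IsContractive.isHermiteConvergent {B : ℤ →₀ Matrix (Fin 2) (Fin 2) ℝ}
    (hB : IsContractive (subdivOp B)) (hd : 1 ≤ d) (hA : HasSpectralOrder A d)
    (hAB : ∀ c, gregoryOp d (subdivOp A c) = ((1 / 2 : ℝ) ^ d) • subdivOp B (gregoryOp d c)) :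
    IsHermiteConvergent A d := by
  refine ⟨fun c hc hbdd => ?_, fun _ _ => ![1, 0], fun _ => 1, isHermiteSeq_const hA, ?_,
    contDiff_const, hermiteTendsto_const, fun h => one_ne_zero (congrFun h 0)⟩
  · obtain ⟨e, rfl⟩ := Nat.exists_eq_add_of_le' hd
    obtain ⟨C, ρ, hE⟩ := hB.isDecaying hAB hbdd
    obtain ⟨φ, h1, h2, h3⟩ := hE.exists_contDiff_limit hA
    refine ⟨φ, h1, hermiteTendsto_of_gridTendsto ?_ ?_⟩
    · simpa only [hc.apply_eq, Matrix.cons_val_zero] using h2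
    · simpa only [hc.apply_eq, Matrix.cons_val_one, Matrix.cons_val_fin_one] using h3
  · refine ((seqNorm_le_iff zero_le_one).2 fun k => ?_).trans_lt ENNReal.ofReal_lt_top
    refine (pi_norm_le_iff_of_nonneg zero_le_one).2 fun a => ?_
    fin_cases a <;> simp

end Convergence

end HermiteSubdivision

theorem corollary1p2 (d : ℕ) (hd : 1 ≤ d) (A : ℤ →₀ Matrix (Fin 2) (Fin 2) ℝ)
    (hA : HermiteSubdivision.HasSpectralOrder A d) :
    (∃ B : ℤ →₀ Matrix (Fin 2) (Fin 2) ℝ, ∀ c : ℤ → Fin 2 → ℝ,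
      HermiteSubdivision.gregoryOp d (HermiteSubdivision.subdivOp A c) =
        ((1 / 2 : ℝ) ^ d) • HermiteSubdivision.subdivOp B (HermiteSubdivision.gregoryOp d c)) ∧
    (∀ B : ℤ →₀ Matrix (Fin 2) (Fin 2) ℝ,
      (∀ c : ℤ → Fin 2 → ℝ,
        HermiteSubdivision.gregoryOp d (HermiteSubdivision.subdivOp A c) =
          ((1 / 2 : ℝ) ^ d) • HermiteSubdivision.subdivOp B (HermiteSubdivision.gregoryOp d c)) →
      HermiteSubdivision.IsContractive (HermiteSubdivision.subdivOp B) →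
      HermiteSubdivision.IsHermiteConvergent A d) :=
  ⟨hA.exists_gregory_factorization hd, fun _ hAB hB => hB.isHermiteConvergent hd hA hAB⟩
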